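/- **Setting.** Fix $\mathcal E,\sigma>0$ and put $\mathrm{SNR}=\mathcal E^2/\sigma^2$. For each number $M\ge 1$ of hypotheses there are $T=T_M\ge M$ time samples, with $T_M/M\to\beta$, $1\le\beta<\infty$. The signals $s_1,\dots,s_M$ have i.i.d. samples $s_i(t)\sim\mathcal N(0,\mathcal E^2)$, $1\le t\le T$, and under hypothesis $k$ one receives $y(t)=s_k(t)+z(t)$, where the $z(t)\sim\mathcal N(0,\sigma^2)$ are i.i.d. and independent of the signals. Let $\mathbf G=(\langle s_i,s_j\rangle)_{i,j}$ be the Gram matrix (almost surely invertible) and $\hat s_j=\sum_l[\mathbf G^{-1}]_{jl}s_l$. For a deterministic sensing matrix $\mathbf A\in\mathbb R^{N\times M}$, $N\le M$, with columns $\mathbf a_1,\dots,\mathbf a_M$, the approximate sufficient statistic is $\mathbf u=(\langle \sum_j a_{mj}\hat s_j,\,y\rangle)_{m=1}^N\in\mathbb R^N$. Error probabilities $P(\mathrm{err})$ are averaged over $M$ equiprobable hypotheses. A sequence of such matrices has compression rate $\alpha$ if $N_M/M\to\alpha$. $E_{\mathrm a}^*(\alpha,\beta,\mathrm{SNR})$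 is the supremum of all real $E$ for which there are sensing matrices $\mathbf A_M\in\mathbb R^{N_M\times M}$, $M=1,2,\dots$, with $N_M\le M$ nondecreasing and compression rate $\alpha$, and (measurable) decoders $\mathbb R^{N_M}\to\{1,\dots,M\}$ applied to $\mathbf u$, with $\liminf_{M\to\infty}-\frac1M\log P(\mathrm{err})\ge E$. A column-normalized group Hadamard matrix is a matrix $\mathbf A=\frac1{\sqrt N}\big((-1)^{\mathrm{Tr}(a_ix_j)}\big)_{1\le i\le N,\,1\le j\le M}$, where $x_1,\dots,x_M$ are the elements of $\mathbb F_{2^r}$ ($M=2^r$, $r\ge1$), $a_1,\dots,a_N$ are those of a subgroup of $\mathbb F_{2^r}^\times$, and $\mathrm{Tr}:\mathbb F_{2^r}\to\mathbb F_2$ is the trace. The modified reduced-dimensionality detector is $\phi_{\mathrm{mRDD}}(\mathbf u)=\arg\max_k\mathbf a_k^T\mathbf u$; the maximum likelihood (ML) detector given the Gram matrix is $\arg\max_k\mathbb P(\mathbf u\mid\mathbf G,k)$, where $\mathbb P(\cdot\mid\mathbf G,k)$ is the Gaussian density with mean $\mathbf a_k$ and covariance $\sigma^2\mathbf A\mathbf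 G^{-1}\mathbf A^T$. Ties are broken arbitrarily. **Theorem.** Let $\beta\ge1$ and $0<\alpha\le1$ with $1/\alpha\in\mathbb N$. 1. $E_{\mathrm a}^*(\alpha,\beta,\mathrm{SNR})\ \ge\ \frac{\beta-1}2\log\big(1+\frac{\alpha\,\mathrm{SNR}}2\big)$. 2. If $1/\alpha$ is odd, there are column-normalized group Hadamard matrices of sizes $N_n\times M_n$ with $M_n\to\infty$ and $N_n/M_n\to\alpha$. For every such sequence (for any $\alpha$ as above), the error exponent of the modified reduced-dimensionality detector satisfies $$E_{\mathrm a}^*(\alpha,\beta,\mathrm{SNR})\ \ge\ E_{\mathrm{a,mRDD}}:=\liminf_{n\to\infty}-\frac1{M_n}\log P_{\mathrm{a,mRDD}}(\mathrm{err})\ =\ \frac{\beta-1}2\log\Big(1+\frac{\alpha\,\mathrm{SNR}}2\Big).$$ This is ensemble-tight: the limit inferior is a limit. The limit is the same if the error probability is conditioned on any single true hypothesis. 3. For the same matrices, this exponent is strictly smaller than the exponent $\liminf_{n\to\infty}-\frac1{M_n}\log P_{\mathrm{a,ML}}(\mathrm{err})$ of the ML detector given the Gram matrix. -/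

import Mathlib

open Filter Topology MeasureTheory ProbabilityTheory
open scoped ENNReal NNReal Matrix

namespace ApproxSuff

noncomputable section

/-! ### The observation model

`M` signals `s i`, each a function of the discrete time `t : Fin T`; under hypothesis `k` one
observes `y t = s k t + z t`. -/

/-- Joint law of the signals and of the noise: all samples `s i t ∼ N(0, 𝓔²)` and
`z t ∼ N(0, σ²)` are independent. -/
def law (M T : ℕ) (𝓔 σ : ℝ) : Measure ((Fin M → Fin T → ℝ) × (Fin T → ℝ)) :=
  (Measure.pi fun _ : Fin M => Measure.pi fun _ : Fin T =>
      gaussianReal 0 (⟨𝓔 ^ 2, sq_nonneg 𝓔⟩ : ℝ≥0)).prod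
    (Measure.pi fun _ : Fin T => gaussianReal 0 (⟨σ ^ 2, sq_nonneg σ⟩ : ℝ≥0))

/-- The signal-to-noise ratio. -/
def snr (𝓔 σ : ℝ) : ℝ := 𝓔 ^ 2 / σ ^ 2

/-- The Gram matrix of the signals (almost surely invertible under `law` when `M ≤ T`). -/
def gram {M T : ℕ} (s : Fin M → Fin T → ℝ) : Matrix (Fin M) (Fin M) ℝ :=
  Matrix.of fun i j => ∑ t, s i t * s j t

/-- The biorthogonal signals. -/
def biorth {M T : ℕ} (s : Fin M → Fin T → ℝ) (j : Fin M) (t : Fin T) : ℝ :=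
  ∑ l, (gram s)⁻¹ j l * s l t

/-- The correlating signals attached to the sensing matrix `A`. -/
def correlator {N M T : ℕ} (A : Matrix (Fin N) (Fin M) ℝ) (s : Fin M → Fin T → ℝ)
    (i : Fin N) (t : Fin T) : ℝ :=
  ∑ j, A i j * biorth s j t

/-- The received signal under hypothesis `k`. -/
def received {M T : ℕ} (k : Fin M) (s : Fin M → Fin T → ℝ) (z : Fin T → ℝ) (t : Fin T) : ℝ :=
  s k t + z t

/-- The approximate sufficient statistic `u` under hypothesis `k`. -/
def stat {N M T : ℕ} (A : Matrix (Fin N) (Fin M) ℝ) (k : Fin M)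
    (s : Fin M → Fin T → ℝ) (z : Fin T → ℝ) : Fin N → ℝ :=
  fun m => ∑ t, correlator A s m t * received k s z t

/-! ### Detectors and their error probabilities -/

/-- Error probability under hypothesis `k` of a detector that decides from `u` and, possibly, the
Gram matrix. A detector `φ` that sees `u` only is used as `fun _ => φ`. -/
def errProb {N M : ℕ} (T : ℕ) (𝓔 σ : ℝ) (A : Matrix (Fin N) (Fin M) ℝ)
    (ψ : Matrix (Fin M) (Fin M) ℝ → (Fin N → ℝ) → Fin M) (k : Fin M) : ℝ≥0∞ :=
  law M T 𝓔 σ {ω | ψ (gram ω.1) (stat A k ω.1 ω.2) ≠ k}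

/-- Error probability when the `M` hypotheses are equiprobable. -/
def avgErrProb {N M : ℕ} (T : ℕ) (𝓔 σ : ℝ) (A : Matrix (Fin N) (Fin M) ℝ)
    (ψ : Matrix (Fin M) (Fin M) ℝ → (Fin N → ℝ) → Fin M) : ℝ≥0∞ :=
  (∑ k, errProb T 𝓔 σ A ψ k) / M

/-- `φ` is a modified reduced-dimensionality detector: `φ u ∈ argmax_k a_kᵀ u`,
where `a_k` is the `k`-th column of `A` (ties are broken arbitrarily). -/
def IsModifiedRDD {N M : ℕ} (A : Matrix (Fin N) (Fin M) ℝ) (φ : (Fin N → ℝ) → Fin M) : Prop :=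
  ∀ u k, A.col k ⬝ᵥ u ≤ A.col (φ u) ⬝ᵥ u

/-- The density of `u` given the Gram matrix `G` and the hypothesis `k`: Gaussian with mean `a_k`
and covariance matrix `σ² A G⁻¹ Aᵀ`. -/
def condDensity {N M : ℕ} (σ : ℝ) (A : Matrix (Fin N) (Fin M) ℝ) (G : Matrix (Fin M) (Fin M) ℝ)
    (k : Fin M) (u : Fin N → ℝ) : ℝ :=
  Real.exp (-(1 / 2) * ((u - A.col k) ⬝ᵥ ((σ ^ 2 • (A * G⁻¹ * Aᵀ))⁻¹ *ᵥ (u - A.col k)))) /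
    Real.sqrt ((2 * Real.pi) ^ N * (σ ^ 2 • (A * G⁻¹ * Aᵀ)).det)

/-- `ψ` is a maximum likelihood detector given the Gram matrix: `ψ G u` maximizes the conditional
density of `u` (ties are broken arbitrarily). -/
def IsMLDetector {N M : ℕ} (σ : ℝ) (A : Matrix (Fin N) (Fin M) ℝ)
    (ψ : Matrix (Fin M) (Fin M) ℝ → (Fin N → ℝ) → Fin M) : Prop :=
  ∀ G u k, condDensity σ A G k u ≤ condDensity σ A G (ψ G u) u

/-! ### Error exponents -/

/-- `-(1/M) log p`, which is `⊤` for `p = 0`. -/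
def rate (M : ℕ+) (p : ℝ≥0∞) : EReal :=
  -(ENNReal.log p) / ((M : ℕ) : EReal)

/-- `e` is an achievable error exponent with compression rate `α`, when `T M` time samples are
available for `M` hypotheses: some sensing matrices of compression rate `α` and some decoders
(functions of `u` only) attain it. -/
def IsAchievable (T : ℕ+ → ℕ) (α 𝓔 σ : ℝ) (e : ℝ) : Prop :=
  ∃ (N : ℕ+ → ℕ) (A : ∀ M : ℕ+, Matrix (Fin (N M)) (Fin M) ℝ)
    (φ : ∀ M : ℕ+, (Fin (N M) → ℝ) → Fin M),
    Monotone N ∧ (∀ M : ℕ+, N M ≤ M) ∧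
    Tendsto (fun M : ℕ+ => (N M : ℝ) / (M : ℕ)) atTop (𝓝 α) ∧
    (∀ M, Measurable (φ M)) ∧
    (e : EReal) ≤
      liminf (fun M : ℕ+ => rate M (avgErrProb (T M) 𝓔 σ (A M) (fun _ => φ M))) atTop

/-- The approximate sufficient statistic error exponent: the supremum of all achievable ones. -/
def optExponent (T : ℕ+ → ℕ) (α 𝓔 σ : ℝ) : EReal :=
  ⨆ (e : ℝ) (_ : IsAchievable T α 𝓔 σ e), (e : EReal)

/-! ### Group Hadamard matrices -/

/-- `A` is a column-normalized group Hadamard matrix: `A i j = (-1) ^ Tr(a_i x_j) / √N`, where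
`x_1, …, x_M` are the elements of the field with `M = 2 ^ r` elements, `a_1, …, a_N` those of a
multiplicative subgroup, and `Tr` is the trace to the field with two elements. -/
def IsNormalizedGroupHadamard {N M : ℕ} (A : Matrix (Fin N) (Fin M) ℝ) : Prop :=
  ∃ (r : ℕ) (_ : 0 < r) (H : Subgroup (GaloisField 2 r)ˣ) (a : Fin N ≃ H)
    (x : Fin M ≃ GaloisField 2 r),
    ∀ i j, A i j = (1 / Real.sqrt N) *
      (-1 : ℝ) ^ (Algebra.trace (ZMod 2) (GaloisField 2 r)
        (((a i : (GaloisField 2 r)ˣ) : GaloisField 2 r) * x j)).val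

/-- `A 0, A 1, …` are column-normalized group Hadamard matrices with compression rate `α`, of
sizes `N n × M n` with `M n → ∞`. -/
structure IsHadamardSeq (α : ℝ) (M : ℕ → ℕ+) (N : ℕ → ℕ)
    (A : ∀ n, Matrix (Fin (N n)) (Fin (M n)) ℝ) : Prop where
  size : Tendsto M atTop atTop
  hadamard : ∀ n, IsNormalizedGroupHadamard (A n)
  compression : Tendsto (fun n => (N n : ℝ) / (M n : ℕ)) atTop (𝓝 α)

end

end ApproxSuff

/-! Both detectors prefer a competitor `j` to the true hypothesis `k` exactly when, up to ties, `⟨Y,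
z⟩ ≥ c ‖Y‖²`, where `z` is the noise, `c` a constant and `Y` a combination of the signals alone. The
coefficients of `Y` range over an affine space `v + K` with `v ⊥ K`, and `Y` is the element of least
energy. Given the signals, the event is a Gaussian tail, of probability at most `exp (-c² ‖Y‖² /
(2σ²))`. Rotating the signals so that `v` involves only the first of them and `K` only the others
shows that `‖Y‖² / (𝓔² |v|²)` is chi-square with `T - dim K` degrees of freedom. Its Laplace
transform gives the pairwise bound `(1 + c² SNR |v|²) ^ (-(T - dim K) / 2)` (`law_le_energy_le`),
and a matching lower bound up to subexponential factors (`le_law_energy_lt`).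

For the modified reduced-dimensionality detector, `K` is the hyperplane orthogonal to `V = Aᵀ (a_j -
a_k)`, of dimension `M - 1`; for maximum likelihood, `K = ker A` has dimension `M - N`. If the
columns are unit vectors with coherence tending to `0` and `A Aᵀ = τ I` with `τ → 1/α`, both bases
tend to `1 + α SNR / 2`. The powers `(T - M + 1)/2` and `(T - M + N)/2` then yield the exponents `(β
- 1)/2 · log` and at least `(β - 1 + α)/2 · log`, whence the strict inequality. The union bound over
`M` competitors costs only `log M / M`, and a single competitor gives the converse for every true
hypothesis.

Group Hadamard matrices qualify: orthogonality of additive characters gives `A Aᵀ = (M/N) I`, and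
invariance of the character sums under the subgroup gives coherence at most `√M / N`. The optimal
exponent needs matrices for every `M` and every integer `1/α`. Columns taken from `1/α` orthonormal
bases of chirps serve there; for an upper bound on the error, the inequality `|Aᵀ w|² ≤ τ |w|²` is
enough. -/

namespace ApproxSuff

/-! ### Standard Gaussian vectors: isometries, projections, Laplace transform, general position. -/

section Gaussian

variable {E F : Type*} [NormedAddCommGroup E] [InnerProductSpace ℝ E] [FiniteDimensional ℝ E]
  [MeasurableSpace E] [BorelSpace E] [NormedAddCommGroup F] [InnerProductSpace ℝ F]
  [FiniteDimensional ℝ F] [MeasurableSpace F] [BorelSpace F]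

/-- The characteristic function of the image at `y` is that of the source at `f' y`, and for a
standard Gaussian it depends on the norm only. -/
lemma map_stdGaussian_of_adjoint {f : E → F} (hf : Measurable f) (f' : F → E)
    (hff' : ∀ x y, inner ℝ (f x) y = inner ℝ x (f' y)) (hf' : ∀ y, ‖f' y‖ = ‖y‖) :
    (stdGaussian E).map f = stdGaussian F := by
  have := Measure.isProbabilityMeasure_map (μ := stdGaussian E) hf.aemeasurable
  apply Measure.ext_of_charFun
  ext t
  rw [charFun_stdGaussian, charFun_apply, integral_map hf.aemeasurable (by fun_prop)]
  simp_rw [hff']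
  rw [← charFun_apply, charFun_stdGaussian, hf']

lemma integral_exp_neg_sq_gaussianReal {l : ℝ} (hl : 0 ≤ l) :
    ∫ x, Real.exp (-(l * x ^ 2)) ∂gaussianReal 0 1 = (1 + 2 * l) ^ (-(1 / 2) : ℝ) := by
  rw [integral_gaussianReal_eq_integral_smul (by simp)]
  have h : ∀ x : ℝ, gaussianPDFReal 0 1 x • Real.exp (-(l * x ^ 2)) =
      (√(2 * Real.pi))⁻¹ * Real.exp (-((1 + 2 * l) / 2) * x ^ 2) := by
    intro x
    simp only [gaussianPDFReal, smul_eq_mul, NNReal.coe_one, mul_one, sub_zero]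
    rw [mul_assoc, ← Real.exp_add]
    congr 2
    ring
  simp_rw [h]
  rw [integral_const_mul, integral_gaussian, Real.rpow_neg (by positivity),
    ← Real.sqrt_eq_rpow, ← Real.sqrt_inv, ← Real.sqrt_inv, ← Real.sqrt_mul (by positivity)]
  congr 1
  field_simp

lemma lintegral_exp_neg_norm_sq_stdGaussian {l : ℝ} (hl : 0 ≤ l) :
    ∫⁻ x, ENNReal.ofReal (Real.exp (-(l * ‖x‖ ^ 2))) ∂stdGaussian F =
      ENNReal.ofReal ((1 + 2 * l) ^ (-(Module.finrank ℝ F / 2) : ℝ)) := by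
  rw [stdGaussian_eq_map_pi_orthonormalBasis (stdOrthonormalBasis ℝ F),
    lintegral_map (by fun_prop) (by fun_prop)]
  have h : ∀ x : Fin (Module.finrank ℝ F) → ℝ,
      Real.exp (-(l * ‖∑ i, x i • stdOrthonormalBasis ℝ F i‖ ^ 2)) =
        ∏ i, Real.exp (-(l * x i ^ 2)) := by
    intro x
    rw [← Real.exp_sum, ← WithLp.ofLp_toLp 2 x, (stdOrthonormalBasis ℝ F).sum_repr_symm,
      LinearIsometryEquiv.norm_map, EuclideanSpace.real_norm_sq_eq, Finset.mul_sum,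
      Finset.sum_neg_distrib]
  have hint : Integrable (fun x : ℝ => Real.exp (-(l * x ^ 2))) (gaussianReal 0 1) := by
    refine Integrable.of_bound (by fun_prop) 1 (Eventually.of_forall fun x => ?_)
    rw [Real.norm_eq_abs, Real.abs_exp, Real.exp_le_one_iff]
    nlinarith [mul_nonneg hl (sq_nonneg x)]
  simp_rw [h]
  rw [← ofReal_integral_eq_lintegral_ofReal, 
    integral_fintype_prod_eq_pow (f := fun x : ℝ => Real.exp (-(l * x ^ 2))),
    integral_exp_neg_sq_gaussianReal hl, Fintype.card_fin, ← Real.rpow_mul_natCast (by positivity)]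
  · congr 2
    ring
  · exact Integrable.fintype_prod (f := fun _ x => Real.exp (-(l * x ^ 2))) fun _ => hint
  · exact Eventually.of_forall fun x => Finset.prod_nonneg fun i _ => (Real.exp_pos _).le

lemma stdGaussian_map_inner {u : F} (hu0 : u ≠ 0) :
    (stdGaussian F).map (fun x => inner ℝ (‖u‖⁻¹ • u) x) = gaussianReal 0 1 := by
  have hmap : (stdGaussian F).map (fun x => inner ℝ (‖u‖⁻¹ • u) x) = stdGaussian ℝ := by
    refine map_stdGaussian_of_adjoint (by fun_prop) (fun c => c • ‖u‖⁻¹ • u) ?_ ?_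
    · intro x y
      simp [real_inner_smul_right, real_inner_comm x]
    · intro y
      simp [norm_smul, hu0]
  have hstd : stdGaussian ℝ = gaussianReal 0 1 := by
    apply Measure.ext_of_charFun
    ext t
    rw [charFun_stdGaussian, charFun_gaussianReal]
    simp [neg_div, ← Complex.ofReal_pow]
  rw [hmap, hstd]

/-- A proper subspace lies in some `u⊥`, and the coordinate along `u` is a real Gaussian, which has
no atoms. -/
lemma stdGaussian_submodule_eq_zero {W : Submodule ℝ F} (hW : W ≠ ⊤) :
    stdGaussian F (W : Set F) = 0 := by
  obtain ⟨u, hu, hu0⟩ := Submodule.exists_mem_ne_zero_of_ne_bot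
    (mt (Submodule.orthogonal_eq_bot_iff (K := W)).1 hW)
  have h1 : stdGaussian F ((fun x => inner ℝ (‖u‖⁻¹ • u) x) ⁻¹' {0}) = 0 := by
    rw [← Measure.map_apply (by fun_prop) (measurableSet_singleton _), stdGaussian_map_inner hu0]
    have := nullSingletonClass_gaussianReal (μ := 0) (v := 1) (by simp)
    simp
  refine measure_mono_null ?_ h1
  intro x hx
  simp [real_inner_smul_left, (Submodule.mem_orthogonal' W u).1 hu x hx]

/-- Induction and Fubini: once `n` vectors are fixed, the next one almost surely avoids their span,
a proper subspace. -/
lemma ae_linearIndependent_stdGaussian : ∀ {n : ℕ}, n ≤ Module.finrank ℝ F →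
    ∀ᵐ g ∂Measure.pi (fun _ : Fin n => stdGaussian F), LinearIndependent ℝ g
  | 0, _ => Eventually.of_forall fun g => linearIndependent_empty_type
  | n + 1, hn => by
    have ih := ae_linearIndependent_stdGaussian (n := n) (by omega)
    have hmp := measurePreserving_piFinSuccAbove (fun _ : Fin (n + 1) => stdGaussian F) 0
    have hmeas : MeasurableSet {g : Fin (n + 1) → F | ¬ LinearIndependent ℝ g} :=
      isOpen_setOfPred_linearIndependent.measurableSet.compl
    rw [ae_iff, ← hmp.symm.measure_preimage hmeas.nullMeasurableSet,
      Measure.prod_apply_symm ((MeasurableEquiv.measurable _) hmeas), lintegral_eq_zero_iff']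
    · filter_upwards [ih] with h hh
      refine measure_mono_null ?_ (stdGaussian_submodule_eq_zero
        (W := Submodule.span ℝ (Set.range h)) ?_)
      · intro x hx
        by_contra hx'
        apply hx
        have := linearIndependent_finCons.2 ⟨hh, hx'⟩
        change LinearIndependent ℝ _
        have hcons : (MeasurableEquiv.piFinSuccAbove (fun _ => F) 0).symm (x, h) =
            (Fin.cons x h : Fin (n + 1) → F) := by
          ext i
          refine Fin.cases ?_ (fun i => ?_) i <;> simp [MeasurableEquiv.piFinSuccAbove]
        rwa [hcons]
      · intro htop
        have := finrank_range_le_card (R := ℝ) h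
        rw [Set.finrank, htop, finrank_top] at this
        simp at this
        omega
    · exact (measurable_measure_prodMk_right
        ((MeasurableEquiv.measurable _) hmeas)).aemeasurable

/-- A family of independent standard Gaussians is one standard Gaussian in the `ℓ²` sum, on which
`O` acts with isometric adjoint `Oᵀ`. -/
lemma measurePreserving_rotation {n : ℕ} {O : Matrix (Fin n) (Fin n) ℝ} (hO : O * Oᵀ = 1) :
    MeasurePreserving (fun (g : Fin n → F) i => ∑ j, O i j • g j)
      (Measure.pi fun _ => stdGaussian F) (Measure.pi fun _ => stdGaussian F) := by
  have hpi : (Measure.pi fun _ : Fin n => stdGaussian F).map (WithLp.toLp 2) =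
      stdGaussian (PiLp 2 fun _ : Fin n => F) := by
    apply Measure.ext_of_charFun
    ext t
    rw [charFun_stdGaussian, charFun_pi]
    simp_rw [charFun_stdGaussian, ← Complex.exp_sum]
    rw [← Complex.ofReal_pow, PiLp.norm_sq_eq_of_L2]
    simp [Finset.sum_div, neg_div]
  have hmeas : Measurable (fun (g : Fin n → F) i => ∑ j, O i j • g j) := by fun_prop
  have hrot : (stdGaussian (PiLp 2 fun _ : Fin n => F)).map
      (fun g => WithLp.toLp 2 (fun i => ∑ j, O i j • g j)) =
        stdGaussian (PiLp 2 fun _ : Fin n => F) := by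
    have hadj : ∀ x y : PiLp 2 fun _ : Fin n => F,
        inner ℝ (WithLp.toLp 2 (fun i => ∑ j, O i j • x j)) y =
          inner ℝ x (WithLp.toLp 2 (fun j => ∑ i, O i j • y i)) := by
      intro x y
      simp only [PiLp.inner_apply, sum_inner, inner_sum, real_inner_smul_left,
        real_inner_smul_right]
      exact Finset.sum_comm
    refine map_stdGaussian_of_adjoint (by fun_prop)
      (fun y => WithLp.toLp 2 (fun j => ∑ i, O i j • y i)) hadj ?_
    intro y
    rw [← sq_eq_sq₀ (norm_nonneg _) (norm_nonneg _), ← real_inner_self_eq_norm_sq, ← hadj,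
      ← real_inner_self_eq_norm_sq]
    congr 1
    ext i
    simp only [Finset.smul_sum, smul_smul]
    rw [Finset.sum_comm]
    simp_rw [← Finset.sum_smul]
    have : ∀ i', ∑ j, O i j * O i' j = if i = i' then 1 else 0 := by
      intro i'
      have := congrFun (congrFun hO i) i'
      simpa [Matrix.mul_apply, Matrix.one_apply] using this
    simp [this]
  refine ⟨hmeas, ?_⟩
  have hofLp : Measurable (WithLp.ofLp : PiLp 2 (fun _ : Fin n => F) → Fin n → F) := by fun_prop
  have htoLp : Measurable (WithLp.toLp 2 : (Fin n → F) → PiLp 2 (fun _ : Fin n => F)) := by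
    fun_prop
  have := congrArg (Measure.map WithLp.ofLp) hrot
  rw [← hpi, Measure.map_map hofLp (by fun_prop), Measure.map_map (by fun_prop) htoLp,
    Measure.map_map hofLp htoLp] at this
  have hid : (WithLp.ofLp ∘ WithLp.toLp 2 : (Fin n → F) → (Fin n → F)) = id := rfl
  rw [hid, Measure.map_id] at this
  exact this

lemma map_orthogonalProjectionOnto_stdGaussian (W : Submodule ℝ F) :
    (stdGaussian F).map W.orthogonalProjectionOnto = stdGaussian W := by
  refine map_stdGaussian_of_adjoint (by fun_prop) (fun y => (y : F)) ?_ (fun _ => rfl)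
  intro x y
  simp

end Gaussian

/-! ### The energy of a minimal combination is a scaled chi-square. -/

section Laplace

lemma exists_orthogonal_first_row {n : ℕ} {v : Fin (n + 1) → ℝ} (hv : v ≠ 0) :
    ∃ O : Matrix (Fin (n + 1)) (Fin (n + 1)) ℝ, O * Oᵀ = 1 ∧ O 0 = (√(v ⬝ᵥ v))⁻¹ • v := by
  have hvv : 0 < v ⬝ᵥ v := by
    have := Matrix.dotProduct_star_self_pos_iff.2 hv
    simpa using this
  have hnorm : ‖(WithLp.toLp 2 ((√(v ⬝ᵥ v))⁻¹ • v) : EuclideanSpace ℝ (Fin (n + 1)))‖ = 1 := by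
    rw [← sq_eq_sq₀ (norm_nonneg _) zero_le_one, EuclideanSpace.real_norm_sq_eq]
    simp only [Pi.smul_apply, smul_eq_mul, mul_pow, ← Finset.mul_sum, inv_pow,
      Real.sq_sqrt hvv.le]
    have : ∑ i, v i ^ 2 = v ⬝ᵥ v := by simp [dotProduct, sq]
    rw [this]
    field_simp
  obtain ⟨b, hb⟩ := Orthonormal.exists_orthonormalBasis_extension_of_card_eq (𝕜 := ℝ)
    (E := EuclideanSpace ℝ (Fin (n + 1))) (ι := Fin (n + 1)) (by simp)
    (v := fun _ => WithLp.toLp 2 ((√(v ⬝ᵥ v))⁻¹ • v)) (s := {0})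
    ⟨fun _ => hnorm, fun i j hij => absurd (Subsingleton.elim i j) hij⟩
  refine ⟨Matrix.of fun i j => b i j, ?_, ?_⟩
  · ext i j
    have := b.inner_eq_ite i j
    simp only [PiLp.inner_apply] at this
    simp only [Matrix.mul_apply, Matrix.one_apply, Matrix.transpose_apply, Matrix.of_apply,
      ← this]
    exact Finset.sum_congr rfl fun k _ => by simp [mul_comm]
  · ext j
    simp [hb 0 rfl]

variable {F : Type*} [NormedAddCommGroup F] [InnerProductSpace ℝ F]
  [FiniteDimensional ℝ F] [MeasurableSpace F] [BorelSpace F]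

lemma lintegral_exp_neg_norm_sq_orthogonalProjectionOnto {l : ℝ} (hl : 0 ≤ l) (W : Submodule ℝ F) :
    ∫⁻ x, ENNReal.ofReal (Real.exp (-(l * ‖Wᗮ.orthogonalProjectionOnto x‖ ^ 2))) ∂stdGaussian F =
      ENNReal.ofReal ((1 + 2 * l) ^
        (-(((Module.finrank ℝ F : ℝ) - Module.finrank ℝ W) / 2))) := by
  have h := lintegral_exp_neg_norm_sq_stdGaussian (F := Wᗮ) hl
  rw [← map_orthogonalProjectionOnto_stdGaussian, lintegral_map (by fun_prop) (by fun_prop)] at h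
  rw [h]
  have := W.finrank_add_finrank_orthogonal
  rw [← this]
  push_cast
  simp

/-- The Laplace transform of the squared distance of a combination of independent standard Gaussian
vectors to the space spanned by orthogonal combinations. -/
lemma lintegral_exp_neg_norm_sq_projection_pi {n : ℕ} (hn : n ≤ Module.finrank ℝ F)
    {l : ℝ} (hl : 0 ≤ l) (K : Submodule ℝ (Fin n → ℝ)) {v : Fin n → ℝ} (hv : v ≠ 0)
    (hvK : ∀ k ∈ K, v ⬝ᵥ k = 0) {Y : (Fin n → F) → F} (hY : Measurable Y)
    (hYK : ∀ g, LinearIndependent ℝ g → (∃ x, x - v ∈ K ∧ Y g = ∑ i, x i • g i) ∧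
      ∀ k ∈ K, inner ℝ (Y g) (∑ i, k i • g i) = 0) :
    ∫⁻ g, ENNReal.ofReal (Real.exp (-(l * ‖Y g‖ ^ 2)))
        ∂Measure.pi (fun _ : Fin n => stdGaussian F) =
      ENNReal.ofReal ((1 + 2 * (l * (v ⬝ᵥ v))) ^
        (-(((Module.finrank ℝ F : ℝ) - Module.finrank ℝ K) / 2))) := by
  obtain _ | n := n
  · exact absurd (Subsingleton.elim v 0) hv
  obtain ⟨O, hO, hO0⟩ := exists_orthogonal_first_row hv
  have hO' : Oᵀ * O = 1 := mul_eq_one_comm.1 hO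
  have hvv : 0 < v ⬝ᵥ v := by
    have := Matrix.dotProduct_star_self_pos_iff.2 hv
    simpa using this
  have hrot := measurePreserving_rotation (F := F) (O := Oᵀ) (by simpa using hO')
  -- Rotating the vectors by `Oᵀ` amounts to rotating the coefficients by `O`.
  have hcomb : ∀ (g : Fin (n + 1) → F) (x : Fin (n + 1) → ℝ),
      ∑ j, x j • ∑ i, Oᵀ j i • g i = ∑ i, (O *ᵥ x) i • g i := by
    intro g x
    simp only [Finset.smul_sum, smul_smul, Matrix.mulVec, dotProduct, Finset.sum_smul]
    rw [Finset.sum_comm]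
    simp [mul_comm]
  -- `O` maps `v` to a multiple of the first basis vector and `K` into its orthogonal complement, so
  -- `v` will involve only the first Gaussian `g0` and `K` only the remaining ones `h`.
  have hOv0 : (O *ᵥ v) 0 = √(v ⬝ᵥ v) := by
    simp only [Matrix.mulVec, hO0, smul_dotProduct, smul_eq_mul]
    rw [inv_mul_eq_div, Real.div_sqrt]
  have hOvs : ∀ i : Fin n, (O *ᵥ v) i.succ = 0 := by
    intro i
    have h1 : (O * Oᵀ) i.succ 0 = 0 := by rw [hO]; simp [Fin.succ_ne_zero]
    have h2 : (O * Oᵀ) i.succ 0 = (√(v ⬝ᵥ v))⁻¹ * (O *ᵥ v) i.succ := by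
      simp only [Matrix.mul_apply, Matrix.transpose_apply, hO0, Matrix.mulVec, dotProduct,
        Finset.mul_sum, Pi.smul_apply, smul_eq_mul]
      exact Finset.sum_congr rfl fun _ _ => by ring
    rw [h2] at h1
    exact (mul_eq_zero.1 h1).resolve_left (by positivity)
  have hOk0 : ∀ k ∈ K, (O *ᵥ k) 0 = 0 := by
    intro k hk
    simp only [Matrix.mulVec, hO0, smul_dotProduct, hvK k hk, smul_zero]
  have hcombk : ∀ k ∈ K, ∀ (g0 : F) (h : Fin n → F),
      ∑ i, (O *ᵥ k) i • (Fin.cons g0 h : Fin (n + 1) → F) i =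
        ∑ i : Fin n, (O *ᵥ k) i.succ • h i := by
    intro k hk g0 h
    simp [Fin.sum_univ_succ, hOk0 k hk]
  have hcombv : ∀ (g0 : F) (h : Fin n → F),
      ∑ i, (O *ᵥ v) i • (Fin.cons g0 h : Fin (n + 1) → F) i = √(v ⬝ᵥ v) • g0 := by
    intro g0 h
    simp [Fin.sum_univ_succ, hOv0, hOvs]
  rw [← hrot.lintegral_comp (by fun_prop),
    ← (measurePreserving_piFinSuccAbove (fun _ : Fin (n + 1) => stdGaussian F) 0).symm
      |>.lintegral_comp (by fun_prop),
    lintegral_prod_symm _ (by fun_prop)]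
  have hcons : ∀ (g0 : F) (h : Fin n → F),
      (MeasurableEquiv.piFinSuccAbove (fun _ => F) 0).symm (g0, h) =
        (Fin.cons g0 h : Fin (n + 1) → F) := by
    intro g0 h
    ext i
    refine Fin.cases ?_ (fun i => ?_) i <;> simp [MeasurableEquiv.piFinSuccAbove]
  simp only [hcons]
  -- With the right side written as the integral of a constant over `h`, it suffices to integrate
  -- over `g0` for almost every fixed `h`.
  rw [← mul_one (ENNReal.ofReal (_ ^ _)), ← measure_univ (μ := Measure.pi fun _ : Fin n =>
    stdGaussian F), ← lintegral_const]
  refine lintegral_congr_ae ?_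
  filter_upwards [ae_linearIndependent_stdGaussian (F := F) (n := n) (by omega)] with h hh
  let Λ : (Fin (n + 1) → ℝ) →ₗ[ℝ] F :=
    { toFun := fun k => ∑ i : Fin n, (O *ᵥ k) i.succ • h i
      map_add' := fun k k' => by simp [Matrix.mulVec_add, add_smul, Finset.sum_add_distrib]
      map_smul' := fun c k => by simp [Matrix.mulVec_smul, mul_smul, Finset.smul_sum] }
  -- The span of the combinations with coefficients in `K`. It depends on `h` only, so it is a fixed
  -- subspace as far as `g0` is concerned.
  set W : Submodule ℝ F := K.map Λ with hW
  have hrank : Module.finrank ℝ W = Module.finrank ℝ K := by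
    rw [hW, ← LinearMap.range_domRestrict]
    refine LinearMap.finrank_range_of_inj ((injective_iff_map_eq_zero _).2 ?_)
    rintro ⟨k, hk⟩ hk0
    have h0 : O *ᵥ k = 0 := by
      ext i
      refine Fin.cases (hOk0 k hk) (fun i => ?_) i
      exact Fintype.linearIndependent_iff.1 hh _ hk0 i
    have : Oᵀ *ᵥ (O *ᵥ k) = 0 := by rw [h0, Matrix.mulVec_zero]
    rw [Matrix.mulVec_mulVec, hO', Matrix.one_mulVec] at this
    exact Subtype.ext this
  have hnull : ∀ᵐ g0 ∂stdGaussian F, g0 ∉ Submodule.span ℝ (Set.range h) := by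
    refine measure_mono_null (fun x hx => not_not.1 hx) (stdGaussian_submodule_eq_zero
        (W := Submodule.span ℝ (Set.range h)) ?_)
    intro htop
    have := finrank_range_le_card (R := ℝ) h
    rw [Set.finrank, htop, finrank_top] at this
    simp at this
    omega
  rw [← hrank, ← lintegral_exp_neg_norm_sq_orthogonalProjectionOnto (by positivity)]
  refine lintegral_congr_ae ?_
  filter_upwards [hnull] with g0 hg0
  have hLIc := linearIndependent_finCons.2 ⟨hh, hg0⟩
  have hLI : LinearIndependent ℝ (fun i => ∑ j, Oᵀ i j • (Fin.cons g0 h : Fin (n + 1) → F) j) := by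
    rw [Fintype.linearIndependent_iff] at hLIc ⊢
    intro x hx
    rw [hcomb] at hx
    have h0 : O *ᵥ x = 0 := funext (hLIc _ hx)
    have : Oᵀ *ᵥ (O *ᵥ x) = 0 := by rw [h0, Matrix.mulVec_zero]
    rw [Matrix.mulVec_mulVec, hO', Matrix.one_mulVec] at this
    exact congrFun this
  obtain ⟨⟨x, hxK, hx⟩, horth⟩ := hYK _ hLI
  set y := Y (fun i => ∑ j, Oᵀ i j • (Fin.cons g0 h : Fin (n + 1) → F) j)
  have hy : y = √(v ⬝ᵥ v) • g0 + Λ (x - v) := by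
    rw [hx, hcomb, ← hcombv g0 h]
    change _ = _ + ∑ i : Fin n, (O *ᵥ (x - v)) i.succ • h i
    rw [← hcombk _ hxK g0 h, ← Finset.sum_add_distrib]
    refine Finset.sum_congr rfl fun i _ => ?_
    rw [← add_smul, Matrix.mulVec_sub]
    simp
  have hyW : y ∈ Wᗮ := by
    rw [Submodule.mem_orthogonal']
    rintro _ ⟨k, hk, rfl⟩
    have := horth k hk
    rw [hcomb, hcombk k hk] at this
    exact this
  -- `y` lies in `Wᗮ` and differs from `√(v ⬝ᵥ v) • g0` by an element of `W`, which the projection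
  -- kills.
  have hproj : Wᗮ.orthogonalProjectionOnto y = √(v ⬝ᵥ v) • Wᗮ.orthogonalProjectionOnto g0 := by
    rw [hy, map_add, map_smul, add_eq_left]
    exact Submodule.orthogonalProjectionOnto_orthogonal_apply_eq_zero
      (Submodule.mem_map_of_mem hxK)
  have hnorm : ‖y‖ ^ 2 = (v ⬝ᵥ v) * ‖Wᗮ.orthogonalProjectionOnto g0‖ ^ 2 := by
    have h1 := Wᗮ.norm_orthogonalProjectionOnto_apply hyW
    rw [← h1, hproj, norm_smul, mul_pow, Real.norm_eq_abs, sq_abs, Real.sq_sqrt hvv.le]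
  rw [hnorm, mul_assoc]

end Laplace

/-! ### Gaussian tail bounds in both directions. -/

section Tail

lemma gaussianReal_ge_le {t : ℝ} (ht : 0 ≤ t) :
    gaussianReal 0 1 {x | t ≤ x} ≤ ENNReal.ofReal (Real.exp (-(t ^ 2 / 2))) := by
  have h := measure_ge_le_exp_mul_mgf (μ := gaussianReal 0 1) (X := id) t ht
    (integrable_exp_mul_gaussianReal t)
  rw [mgf_id_gaussianReal] at h
  rw [← ofReal_measureReal]
  refine ENNReal.ofReal_le_ofReal (h.trans_eq ?_)
  rw [← Real.exp_add]
  congr 1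
  simp
  ring

/-- The density on `(t, t + 1]` is bounded below by its value at `t + 1`, and the cross term of `(t
+ 1)²` is absorbed by `2t ≤ ε t² + 1/ε`. The result is again the exponential of a multiple of `t²`,
so the Laplace transform applies to it as well. -/
lemma le_gaussianReal_gt {t ε : ℝ} (ht : 0 ≤ t) (hε : 0 < ε) :
    ENNReal.ofReal ((√(2 * Real.pi))⁻¹ * Real.exp (-((1 + 1 / ε) / 2)) *
      Real.exp (-((1 + ε) * t ^ 2 / 2))) ≤ gaussianReal 0 1 {x | t < x} := by
  have hbound : ∀ x ∈ Set.Ioc t (t + 1), (√(2 * Real.pi))⁻¹ * Real.exp (-((1 + 1 / ε) / 2)) *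
      Real.exp (-((1 + ε) * t ^ 2 / 2)) ≤ gaussianPDFReal 0 1 x := by
    intro x hx
    simp only [gaussianPDFReal, NNReal.coe_one, mul_one, sub_zero]
    rw [mul_assoc, ← Real.exp_add]
    gcongr
    have h1 : x ^ 2 ≤ (t + 1) ^ 2 := by
      have := hx.1; have := hx.2
      gcongr
      linarith
    have h2 : 2 * t ≤ ε * t ^ 2 + 1 / ε := by
      have : ε * t ^ 2 + 1 / ε - 2 * t = (ε * t - 1) ^ 2 / ε := by field_simp; ring
      have h3 : 0 ≤ (ε * t - 1) ^ 2 / ε := by positivity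
      linarith
    linarith
  calc _ = ∫⁻ _ in Set.Ioc t (t + 1), ENNReal.ofReal ((√(2 * Real.pi))⁻¹ *
        Real.exp (-((1 + 1 / ε) / 2)) * Real.exp (-((1 + ε) * t ^ 2 / 2))) := by simp
    _ ≤ ∫⁻ x in Set.Ioc t (t + 1), gaussianPDF 0 1 x :=
        setLIntegral_mono' measurableSet_Ioc fun x hx => ENNReal.ofReal_le_ofReal (hbound x hx)
    _ = gaussianReal 0 1 (Set.Ioc t (t + 1)) := (gaussianReal_apply 0 (by simp) _).symm
    _ ≤ _ := measure_mono fun x hx => hx.1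

variable {F : Type*} [NormedAddCommGroup F] [InnerProductSpace ℝ F]
  [FiniteDimensional ℝ F] [MeasurableSpace F] [BorelSpace F]

lemma stdGaussian_inner_ge_le (q : F) {c : ℝ} (hc : 0 ≤ c) :
    stdGaussian F {z | c * ‖q‖ ^ 2 ≤ inner ℝ q z} ≤
      ENNReal.ofReal (Real.exp (-(c ^ 2 / 2 * ‖q‖ ^ 2))) := by
  obtain rfl | hq := eq_or_ne q 0
  · simp
  have hq' : 0 < ‖q‖ := norm_pos_iff.2 hq
  have hset : {z | c * ‖q‖ ^ 2 ≤ inner ℝ q z} =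
      (fun x => inner ℝ (‖q‖⁻¹ • q) x) ⁻¹' {x | c * ‖q‖ ≤ x} := by
    ext z
    simp only [Set.mem_ofPred_eq, Set.mem_preimage, real_inner_smul_left]
    rw [inv_mul_eq_div, le_div_iff₀ hq', mul_assoc, sq]
  rw [hset, ← Measure.map_apply (by fun_prop) (measurableSet_le (by fun_prop) (by fun_prop)),
    stdGaussian_map_inner hq]
  refine (gaussianReal_ge_le (by positivity)).trans_eq ?_
  congr 3
  ring

lemma le_stdGaussian_inner_gt {q : F} (hq : q ≠ 0) {c ε : ℝ} (hc : 0 ≤ c) (hε : 0 < ε) :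
    ENNReal.ofReal ((√(2 * Real.pi))⁻¹ * Real.exp (-((1 + 1 / ε) / 2)) *
      Real.exp (-((1 + ε) * c ^ 2 / 2 * ‖q‖ ^ 2))) ≤
      stdGaussian F {z | c * ‖q‖ ^ 2 < inner ℝ q z} := by
  have hq' : 0 < ‖q‖ := norm_pos_iff.2 hq
  have hset : {z | c * ‖q‖ ^ 2 < inner ℝ q z} =
      (fun x => inner ℝ (‖q‖⁻¹ • q) x) ⁻¹' {x | c * ‖q‖ < x} := by
    ext z
    simp only [Set.mem_ofPred_eq, Set.mem_preimage, real_inner_smul_left]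
    rw [inv_mul_eq_div, lt_div_iff₀ hq', mul_assoc, sq]
  rw [hset, ← Measure.map_apply (by fun_prop) (measurableSet_lt (by fun_prop) (by fun_prop)),
    stdGaussian_map_inner hq]
  refine Eq.trans_le ?_ (le_gaussianReal_gt (by positivity) hε)
  congr 4
  ring

end Tail

/-! ### Pairwise error events under the law of signals and noise. -/

section Law

lemma pi_gaussianReal_eq_map_stdGaussian (T : ℕ) (τ : ℝ) :
    Measure.pi (fun _ : Fin T => gaussianReal 0 (⟨τ ^ 2, sq_nonneg τ⟩ : ℝ≥0)) =
      (stdGaussian (EuclideanSpace ℝ (Fin T))).map (fun x t => τ * x t) := by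
  rw [← map_pi_eq_stdGaussian, Measure.map_map (by fun_prop) (by fun_prop)]
  have h := gaussianReal_map_const_mul (μ := 0) (v := 1) τ
  rw [mul_zero, mul_one] at h
  have h' : (fun _ : Fin T => gaussianReal 0 (⟨τ ^ 2, sq_nonneg τ⟩ : ℝ≥0)) =
      fun _ => (gaussianReal 0 1).map (τ * ·) := funext fun _ => h.symm
  have := Measure.isProbabilityMeasure_map (μ := gaussianReal 0 1) (f := (τ * ·)) (by fun_prop)
  rw [h', ← Measure.pi_map_pi fun _ => by fun_prop]
  rfl

/-- The samples expressed through standard Gaussian vectors. -/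
noncomputable def scaleSamples {M T : ℕ} (𝓔 σ : ℝ)
    (p : (Fin M → EuclideanSpace ℝ (Fin T)) × EuclideanSpace ℝ (Fin T)) :
    (Fin M → Fin T → ℝ) × (Fin T → ℝ) :=
  (fun i t => 𝓔 * p.1 i t, fun t => σ * p.2 t)

lemma measurable_scaleSamples {M T : ℕ} (𝓔 σ : ℝ) :
    Measurable (scaleSamples (M := M) (T := T) 𝓔 σ) := by
  unfold scaleSamples
  fun_prop

lemma law_eq_map (M T : ℕ) (𝓔 σ : ℝ) :
    law M T 𝓔 σ = ((Measure.pi fun _ : Fin M => stdGaussian (EuclideanSpace ℝ (Fin T))).prod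
      (stdGaussian (EuclideanSpace ℝ (Fin T)))).map (scaleSamples 𝓔 σ) := by
  unfold law
  simp_rw [pi_gaussianReal_eq_map_stdGaussian]
  have := Measure.isProbabilityMeasure_map (μ := stdGaussian (EuclideanSpace ℝ (Fin T)))
    (f := fun x t => 𝓔 * x t) (by fun_prop)
  rw [← Measure.pi_map_pi fun _ => by fun_prop, Measure.map_prod_map _ _ (by fun_prop)
    (by fun_prop)]
  rfl

lemma linearIndependent_scale {M T : ℕ} {𝓔 : ℝ} (h𝓔 : 0 < 𝓔)
    {g : Fin M → EuclideanSpace ℝ (Fin T)} (hg : LinearIndependent ℝ g) :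
    LinearIndependent ℝ (fun i t => 𝓔 * g i t) := by
  rw [Fintype.linearIndependent_iff] at hg ⊢
  intro x hx
  refine hg x ?_
  ext t
  have := congrFun hx t
  simp only [Finset.sum_apply, Pi.smul_apply, smul_eq_mul, mul_left_comm _ 𝓔,
    ← Finset.mul_sum, Pi.zero_apply] at this
  simpa using (mul_eq_zero.1 this).resolve_left h𝓔.ne'

lemma ae_law_linearIndependent {M T : ℕ} (hMT : M ≤ T) {𝓔 : ℝ} (h𝓔 : 0 < 𝓔) (σ : ℝ) :
    ∀ᵐ ω ∂law M T 𝓔 σ, LinearIndependent ℝ ω.1 := by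
  have hmeas : MeasurableSet {ω : (Fin M → Fin T → ℝ) × (Fin T → ℝ) |
      LinearIndependent ℝ ω.1} :=
    measurable_fst (isOpen_setOfPred_linearIndependent.measurableSet :
      MeasurableSet {f : Fin M → Fin T → ℝ | LinearIndependent ℝ f})
  rw [law_eq_map, ae_map_iff (measurable_scaleSamples 𝓔 σ).aemeasurable hmeas]
  have h := ae_linearIndependent_stdGaussian (F := EuclideanSpace ℝ (Fin T)) (n := M) (by simpa)
  filter_upwards [Measure.quasiMeasurePreserving_fst.ae h] with p hp
  exact linearIndependent_scale h𝓔 hp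

variable {M T : ℕ} {𝓔 σ : ℝ} {K : Submodule ℝ (Fin M → ℝ)} {v : Fin M → ℝ}
  {Y : (Fin M → Fin T → ℝ) → Fin T → ℝ}

/-- `Y s` is the combination of the signals with coefficients in `v + K` of smallest energy. -/
def IsMinimalCombination (K : Submodule ℝ (Fin M → ℝ)) (v : Fin M → ℝ)
    (Y : (Fin M → Fin T → ℝ) → Fin T → ℝ) : Prop :=
  ∀ s, LinearIndependent ℝ s → (∃ x, x - v ∈ K ∧ Y s = ∑ i, x i • s i) ∧
      ∀ k ∈ K, Y s ⬝ᵥ (∑ i, k i • s i) = 0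

lemma euclidean_norm_toLp_sq (y : Fin T → ℝ) :
    ‖(WithLp.toLp 2 y : EuclideanSpace ℝ (Fin T))‖ ^ 2 = y ⬝ᵥ y := by
  rw [EuclideanSpace.real_norm_sq_eq]
  simp [dotProduct, sq]

lemma lintegral_exp_neg_energy (hMT : M ≤ T) (h𝓔 : 0 < 𝓔) (hv : v ≠ 0)
    (hvK : ∀ k ∈ K, v ⬝ᵥ k = 0) (hY : Measurable Y) (hYK : IsMinimalCombination K v Y)
    {l : ℝ} (hl : 0 ≤ l) :
    ∫⁻ g : Fin M → EuclideanSpace ℝ (Fin T), ENNReal.ofReal (Real.exp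
        (-(l * ‖(WithLp.toLp 2 (Y fun i t => 𝓔 * g i t) : EuclideanSpace ℝ (Fin T))‖ ^ 2)))
        ∂Measure.pi (fun _ => stdGaussian (EuclideanSpace ℝ (Fin T))) =
      ENNReal.ofReal ((1 + 2 * l * 𝓔 ^ 2 * (v ⬝ᵥ v)) ^
        (-(((T : ℝ) - Module.finrank ℝ K) / 2))) := by
  -- Dividing `Y` by `𝓔` makes it a combination of standard Gaussians; the factor `𝓔 ^ 2` moves into
  -- the Laplace parameter.
  have h := lintegral_exp_neg_norm_sq_projection_pi (F := EuclideanSpace ℝ (Fin T)) (n := M)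
    (by simpa) (l := l * 𝓔 ^ 2) (by positivity) K hv hvK
    (Y := fun g => 𝓔⁻¹ • WithLp.toLp 2 (Y fun i t => 𝓔 * g i t)) (by fun_prop) ?_
  · simp only [norm_smul, mul_pow, norm_inv, inv_pow, Real.norm_eq_abs, sq_abs] at h
    rw [finrank_euclideanSpace_fin] at h
    have h1 : ∀ r : ℝ, l * 𝓔 ^ 2 * ((𝓔 ^ 2)⁻¹ * r) = l * r := fun r => by field_simp
    simp only [h1] at h
    rw [h]
    congr 3
    ring
  · intro g hg
    have hLI := linearIndependent_scale h𝓔 hg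
    obtain ⟨⟨x, hx, hYx⟩, horth⟩ := hYK _ hLI
    refine ⟨⟨x, hx, ?_⟩, fun k hk => ?_⟩
    · ext t
      simp only [hYx, PiLp.smul_apply, Finset.sum_apply, Pi.smul_apply, smul_eq_mul,
        mul_left_comm _ 𝓔, ← Finset.mul_sum]
      rw [mul_inv_cancel_left₀ h𝓔.ne']
      simp
    · have h1 := horth k hk
      have h2 : (∑ i, k i • fun t => 𝓔 * g i t) = 𝓔 • (∑ i, k i • g i).ofLp := by
        ext t
        simp [Finset.mul_sum, mul_left_comm _ 𝓔]
      rw [h2, dotProduct_smul, smul_eq_mul, mul_eq_zero, or_iff_right h𝓔.ne'] at h1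
      rw [real_inner_smul_left, PiLp.inner_apply]
      simp only [dotProduct] at h1
      simp only [RCLike.inner_apply, conj_trivial, mul_comm _ (Y _ _), h1, mul_zero]

lemma law_apply_eq_lintegral {S : Set ((Fin M → Fin T → ℝ) × (Fin T → ℝ))}
    (hS : MeasurableSet S) :
    law M T 𝓔 σ S = ∫⁻ g : Fin M → EuclideanSpace ℝ (Fin T),
      stdGaussian (EuclideanSpace ℝ (Fin T)) {h | scaleSamples 𝓔 σ (g, h) ∈ S}
      ∂Measure.pi (fun _ => stdGaussian (EuclideanSpace ℝ (Fin T))) := by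
  rw [law_eq_map, Measure.map_apply (measurable_scaleSamples 𝓔 σ) hS,
    Measure.prod_apply (measurable_scaleSamples 𝓔 σ hS)]
  rfl

lemma inner_toLp_eq (y : Fin T → ℝ) (h : EuclideanSpace ℝ (Fin T)) :
    y ⬝ᵥ (fun t => σ * h t) = σ * inner ℝ (WithLp.toLp 2 y) h := by
  simp [dotProduct, PiLp.inner_apply, Finset.mul_sum, mul_left_comm, mul_comm]

/-- For fixed signals the noise tail is at most `exp (-(c/σ)² ‖Y‖² / 2)`; averaging over the signals
is the Laplace transform of the energy at `(c/σ)² / 2`. -/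
lemma law_le_energy_le (hMT : M ≤ T) (h𝓔 : 0 < 𝓔) (hσ : 0 < σ) (hv : v ≠ 0)
    (hvK : ∀ k ∈ K, v ⬝ᵥ k = 0) (hY : Measurable Y) (hYK : IsMinimalCombination K v Y)
    {c : ℝ} (hc : 0 ≤ c) :
    law M T 𝓔 σ {ω | c * (Y ω.1 ⬝ᵥ Y ω.1) ≤ Y ω.1 ⬝ᵥ ω.2} ≤
      ENNReal.ofReal ((1 + c ^ 2 * snr 𝓔 σ * (v ⬝ᵥ v)) ^
        (-(((T : ℝ) - Module.finrank ℝ K) / 2))) := by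
  have h := lintegral_exp_neg_energy hMT h𝓔 hv hvK hY hYK (l := (c / σ) ^ 2 / 2) (by positivity)
  have hsnr : 1 + c ^ 2 * snr 𝓔 σ * (v ⬝ᵥ v) =
      1 + 2 * ((c / σ) ^ 2 / 2) * 𝓔 ^ 2 * (v ⬝ᵥ v) := by
    rw [snr]; field_simp
  rw [hsnr, ← h, law_apply_eq_lintegral (measurableSet_le (by fun_prop) (by fun_prop))]
  refine lintegral_mono fun g => ?_
  refine le_trans (measure_mono fun z hz => ?_) (stdGaussian_inner_ge_le _ (by positivity))
  simp only [scaleSamples, Set.mem_ofPred_eq] at hz ⊢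
  rw [inner_toLp_eq] at hz
  rw [euclidean_norm_toLp_sq, div_mul_eq_mul_div, div_le_iff₀ hσ, mul_comm _ σ]
  exact hz

lemma le_law_energy_lt (hMT : M ≤ T) (h𝓔 : 0 < 𝓔) (hσ : 0 < σ) (hv : v ≠ 0)
    (hvK : ∀ k ∈ K, v ⬝ᵥ k = 0) (hY : Measurable Y) (hYK : IsMinimalCombination K v Y)
    {c ε : ℝ} (hc : 0 ≤ c) (hε : 0 < ε) :
    ENNReal.ofReal ((√(2 * Real.pi))⁻¹ * Real.exp (-((1 + 1 / ε) / 2)) *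
      (1 + (1 + ε) * c ^ 2 * snr 𝓔 σ * (v ⬝ᵥ v)) ^
        (-(((T : ℝ) - Module.finrank ℝ K) / 2))) ≤
    law M T 𝓔 σ {ω | c * (Y ω.1 ⬝ᵥ Y ω.1) < Y ω.1 ⬝ᵥ ω.2} := by
  have h := lintegral_exp_neg_energy hMT h𝓔 hv hvK hY hYK
    (l := (1 + ε) * (c / σ) ^ 2 / 2) (by positivity)
  have hsnr : 1 + (1 + ε) * c ^ 2 * snr 𝓔 σ * (v ⬝ᵥ v) =
      1 + 2 * ((1 + ε) * (c / σ) ^ 2 / 2) * 𝓔 ^ 2 * (v ⬝ᵥ v) := by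
    rw [snr]; field_simp
  rw [hsnr, ENNReal.ofReal_mul (by positivity), ← h,
    law_apply_eq_lintegral (measurableSet_lt (by fun_prop) (by fun_prop)),
    ← lintegral_const_mul _ (by fun_prop)]
  refine lintegral_mono_ae ?_
  filter_upwards [ae_linearIndependent_stdGaussian (F := EuclideanSpace ℝ (Fin T)) (n := M)
    (by simpa)] with g hg
  have hLI := linearIndependent_scale h𝓔 hg
  -- `Y = 0` would force zero coefficients, hence `-v ∈ K`; since `v ⊥ K`, this would give `v = 0`.
  have hY0 : (WithLp.toLp 2 (Y fun i t => 𝓔 * g i t) : EuclideanSpace ℝ (Fin T)) ≠ 0 := by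
    intro h0
    obtain ⟨⟨x, hx, hYx⟩, -⟩ := hYK _ hLI
    have h1 : Y (fun i t => 𝓔 * g i t) = 0 := by simpa using h0
    rw [hYx] at h1
    have hx0 : x = 0 := funext (Fintype.linearIndependent_iff.1 hLI x h1)
    rw [hx0, zero_sub] at hx
    have := hvK _ hx
    rw [dotProduct_neg, neg_eq_zero, dotProduct_self_eq_zero] at this
    exact hv this
  rw [← ENNReal.ofReal_mul (by positivity)]
  refine le_trans ?_ ((le_stdGaussian_inner_gt hY0 (c := c / σ) (by positivity) hε).trans
    (measure_mono fun z hz => ?_))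
  · exact le_rfl
  · simp only [scaleSamples, Set.mem_ofPred_eq] at hz ⊢
    rw [inner_toLp_eq]
    rwa [euclidean_norm_toLp_sq, div_mul_eq_mul_div, div_lt_iff₀ hσ, mul_comm _ σ] at hz

end Law

/-! ### The statistic and dual combinations in terms of the Gram matrix. -/

section GramMatrix

variable {M N T : ℕ}

lemma measurable_matrix_det {α n : Type*} [MeasurableSpace α] [Fintype n] [DecidableEq n]
    {f : α → Matrix n n ℝ} (hf : ∀ i j, Measurable fun a => f a i j) :
    Measurable fun a => (f a).det := by
  simp_rw [Matrix.det_apply]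
  fun_prop

lemma measurable_matrix_inv {α n : Type*} [MeasurableSpace α] [Fintype n] [DecidableEq n]
    {f : α → Matrix n n ℝ} (hf : ∀ i j, Measurable fun a => f a i j) (i j : n) :
    Measurable fun a => (f a)⁻¹ i j := by
  simp_rw [Matrix.inv_def, Ring.inverse_eq_inv', Matrix.smul_apply, Matrix.adjugate_apply,
    smul_eq_mul]
  refine (measurable_matrix_det hf).inv.mul (measurable_matrix_det fun a b => ?_)
  simp_rw [Matrix.updateRow_apply]
  split_ifs
  · fun_prop
  · exact hf a b

lemma measurable_gram_inv (i j : Fin M) :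
    Measurable fun s : Fin M → Fin T → ℝ => (gram s)⁻¹ i j := by
  refine measurable_matrix_inv (fun a b => ?_) i j
  simp only [gram, Matrix.of_apply]
  fun_prop

lemma gram_eq_mul (s : Fin M → Fin T → ℝ) :
    gram s = (Matrix.of s : Matrix (Fin M) (Fin T) ℝ) * (Matrix.of s : Matrix _ _ ℝ)ᵀ := by
  ext i j
  simp [gram, Matrix.mul_apply]

lemma sum_smul_eq_mulVec (s : Fin M → Fin T → ℝ) (x : Fin M → ℝ) :
    ∑ i, x i • s i = (Matrix.of s : Matrix (Fin M) (Fin T) ℝ)ᵀ *ᵥ x := by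
  ext t
  simp [Matrix.mulVec, dotProduct, mul_comm]

lemma gram_posDef {s : Fin M → Fin T → ℝ} (hs : LinearIndependent ℝ s) : (gram s).PosDef := by
  have h := Matrix.PosDef.conjTranspose_mul_self
    ((Matrix.of s : Matrix (Fin M) (Fin T) ℝ)ᵀ) ?_
  · rw [gram_eq_mul]
    simpa [Matrix.conjTranspose_eq_transpose_of_trivial] using h
  · refine (injective_iff_map_eq_zero (Matrix.mulVecLin _)).2 fun x hx => ?_
    rw [Matrix.mulVecLin_apply, ← sum_smul_eq_mulVec] at hx
    exact funext (Fintype.linearIndependent_iff.1 hs x hx)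

lemma gram_isUnit_det {s : Fin M → Fin T → ℝ} (hs : LinearIndependent ℝ s) :
    IsUnit (gram s).det := (gram_posDef hs).det_pos.ne'.isUnit

/-- Biorthogonality, `G⁻¹ S Sᵀ = 1` for the matrix `S` of signals, makes the signal part of `u`
exactly `a_k`; only the noise part still depends on the signals. -/
lemma stat_eq {A : Matrix (Fin N) (Fin M) ℝ} {s : Fin M → Fin T → ℝ}
    (hs : LinearIndependent ℝ s) (k : Fin M) (z : Fin T → ℝ) :
    stat A k s z = A.col k + A *ᵥ ((gram s)⁻¹ *ᵥ ((Matrix.of s : Matrix _ _ ℝ) *ᵥ z)) := by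
  set S : Matrix (Fin M) (Fin T) ℝ := Matrix.of s
  have h1 : stat A k s z = (A * ((gram s)⁻¹ * S)) *ᵥ (s k + z) := by
    ext m
    simp only [stat, correlator, biorth, received, Matrix.mulVec, dotProduct, Matrix.mul_apply,
      Pi.add_apply]
    rfl
  have h2 : s k = Sᵀ *ᵥ (Pi.single k 1) := by
    rw [Matrix.mulVec_single_one]
    rfl
  rw [h1, Matrix.mulVec_add, h2, Matrix.mulVec_mulVec, Matrix.mul_assoc, Matrix.mul_assoc,
    ← gram_eq_mul, Matrix.nonsing_inv_mul _ (gram_isUnit_det hs), Matrix.mul_one,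
    Matrix.mulVec_single_one]
  simp [Matrix.mulVec_mulVec]

/-- The linear combination of the signals with coefficients `G⁻¹ p`. -/
noncomputable def dualCombination (p : (Fin M → Fin T → ℝ) → Fin M → ℝ)
    (s : Fin M → Fin T → ℝ) : Fin T → ℝ :=
  ∑ i, ((gram s)⁻¹ *ᵥ p s) i • s i

lemma measurable_dualCombination {p : (Fin M → Fin T → ℝ) → Fin M → ℝ} (hp : Measurable p) :
    Measurable (dualCombination p) := by
  unfold dualCombination
  have := measurable_gram_inv (M := M) (T := T)
  simp only [Matrix.mulVec, dotProduct]
  refine Finset.measurable_sum _ fun i _ => Measurable.fun_smul ?_ (measurable_pi_apply i)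
  exact Finset.measurable_sum _ fun j _ => (this i j).mul (measurable_pi_iff.1 hp j)

lemma dualCombination_dotProduct (p : (Fin M → Fin T → ℝ) → Fin M → ℝ)
    (s : Fin M → Fin T → ℝ) (z : Fin T → ℝ) :
    dualCombination p s ⬝ᵥ z =
      p s ⬝ᵥ ((gram s)⁻¹ *ᵥ ((Matrix.of s : Matrix _ _ ℝ) *ᵥ z)) := by
  have hsymm : ((gram s)⁻¹)ᵀ = (gram s)⁻¹ := by
    rw [Matrix.transpose_nonsing_inv, gram_eq_mul]
    simp
  rw [dualCombination, sum_smul_eq_mulVec, dotProduct_comm, Matrix.dotProduct_mulVec,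
    Matrix.vecMul_transpose, Matrix.dotProduct_mulVec, ← Matrix.mulVec_transpose, hsymm,
    dotProduct_comm]

lemma dualCombination_dotProduct_sum {s : Fin M → Fin T → ℝ} (hs : LinearIndependent ℝ s)
    (p : (Fin M → Fin T → ℝ) → Fin M → ℝ) (x : Fin M → ℝ) :
    dualCombination p s ⬝ᵥ (∑ i, x i • s i) = p s ⬝ᵥ x := by
  rw [dualCombination_dotProduct, sum_smul_eq_mulVec, Matrix.mulVec_mulVec, Matrix.mulVec_mulVec,
    Matrix.mul_assoc, ← gram_eq_mul, Matrix.nonsing_inv_mul _ (gram_isUnit_det hs), Matrix.one_mulVec]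

lemma dualCombination_dotProduct_self {s : Fin M → Fin T → ℝ} (hs : LinearIndependent ℝ s)
    (p : (Fin M → Fin T → ℝ) → Fin M → ℝ) :
    dualCombination p s ⬝ᵥ dualCombination p s = p s ⬝ᵥ ((gram s)⁻¹ *ᵥ p s) := by
  conv_lhs => rw [show dualCombination p s ⬝ᵥ dualCombination p s =
    dualCombination p s ⬝ᵥ (∑ i, ((gram s)⁻¹ *ᵥ p s) i • s i) from rfl]
  exact dualCombination_dotProduct_sum hs p _

/-- Since `G⁻¹` cancels against the Gram matrix, orthogonality of the combination to the signals
weighted by `k` reduces to `p ⊥ k` for the coefficient vectors. -/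
lemma isMinimalCombination_dualCombination {K : Submodule ℝ (Fin M → ℝ)} {v : Fin M → ℝ}
    {p : (Fin M → Fin T → ℝ) → Fin M → ℝ}
    (hp : ∀ s, LinearIndependent ℝ s → (gram s)⁻¹ *ᵥ p s - v ∈ K ∧ ∀ k ∈ K, p s ⬝ᵥ k = 0) :
    IsMinimalCombination K v (dualCombination p) := fun s hs =>
  ⟨⟨_, (hp s hs).1, rfl⟩, fun k hk => by
    rw [dualCombination_dotProduct_sum hs, (hp s hs).2 k hk]⟩

lemma dotProduct_gram_inv_pos {s : Fin M → Fin T → ℝ} (hs : LinearIndependent ℝ s)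
    {V : Fin M → ℝ} (hV : V ≠ 0) : 0 < V ⬝ᵥ ((gram s)⁻¹ *ᵥ V) := by
  simpa using (gram_posDef hs).inv.dotProduct_mulVec_pos hV

end GramMatrix

/-! ### Pairwise errors of the modified reduced-dimensionality detector. -/

section ReducedDimensionality

variable {M N T : ℕ} {𝓔 σ : ℝ}

/-- The scaling of `V` for which `G⁻¹ p` has scalar product `1` with `V`. -/
noncomputable def normalizedDirection (V : Fin M → ℝ) (s : Fin M → Fin T → ℝ) : Fin M → ℝ :=
  (V ⬝ᵥ ((gram s)⁻¹ *ᵥ V))⁻¹ • V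

lemma measurable_normalizedDirection (V : Fin M → ℝ) :
    Measurable (normalizedDirection (T := T) V) := by
  unfold normalizedDirection
  have := measurable_gram_inv (M := M) (T := T)
  simp only [Matrix.mulVec, dotProduct]
  refine Measurable.fun_smul (Measurable.fun_inv ?_) measurable_const
  exact Finset.measurable_sum _ fun i _ => (Finset.measurable_sum _ fun j _ =>
    (this i j).mul_const _).const_mul _

lemma dotProduct_self_pos {n : ℕ} {V : Fin n → ℝ} (hV : V ≠ 0) : 0 < V ⬝ᵥ V := by
  simpa using Matrix.dotProduct_star_self_pos_iff.2 hV

/-- The hyperplane orthogonal to `V`. -/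
def hyperplane (V : Fin M → ℝ) : Submodule ℝ (Fin M → ℝ) :=
  LinearMap.ker (dotProductBilin ℝ ℝ V)

lemma mem_hyperplane {V x : Fin M → ℝ} : x ∈ hyperplane V ↔ V ⬝ᵥ x = 0 := Iff.rfl

lemma finrank_hyperplane {V : Fin M → ℝ} (hV : V ≠ 0) :
    (Module.finrank ℝ (hyperplane V) : ℝ) = M - 1 := by
  have h := Module.Dual.finrank_ker_add_one_of_ne_zero (f := dotProductBilin ℝ ℝ V) ?_
  · rw [Module.finrank_fin_fun] at h
    exact eq_sub_of_add_eq (mod_cast h)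
  · intro h0
    have : V ⬝ᵥ V = 0 := congrArg (fun f => f V) h0
    exact (dotProduct_self_pos hV).ne' this

lemma isMinimalCombination_hyperplane {V : Fin M → ℝ} (hV : V ≠ 0) :
    IsMinimalCombination (T := T) (hyperplane V) ((V ⬝ᵥ V)⁻¹ • V)
      (dualCombination (normalizedDirection V)) := by
  refine isMinimalCombination_dualCombination fun s hs => ⟨?_, fun k hk => ?_⟩
  · rw [mem_hyperplane, normalizedDirection, Matrix.mulVec_smul, dotProduct_sub, dotProduct_smul,
      dotProduct_smul, smul_eq_mul, smul_eq_mul, inv_mul_cancel₀ (dotProduct_gram_inv_pos hs hV).ne',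
      inv_mul_cancel₀ (dotProduct_self_pos hV).ne', sub_self]
  · rw [normalizedDirection, smul_dotProduct, mem_hyperplane.1 hk, smul_zero]

variable {A : Matrix (Fin N) (Fin M) ℝ} {j k : Fin M}

/-- The score difference is `V ⬝ G⁻¹ S z - c` with `c = a_k ⬝ (a_k - a_j)`. The positive factor `1 /
(V ⬝ G⁻¹ V)` equals the energy of the normalized combination `Y`, so scaling by it gives `⟨Y, z⟩ - c
‖Y‖²`. -/
lemma col_dotProduct_stat_sub {s : Fin M → Fin T → ℝ} (hs : LinearIndependent ℝ s)
    (hV : Aᵀ *ᵥ (A.col j - A.col k) ≠ 0) (z : Fin T → ℝ) :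
    (A.col j ⬝ᵥ stat A k s z - A.col k ⬝ᵥ stat A k s z) *
        ((Aᵀ *ᵥ (A.col j - A.col k)) ⬝ᵥ ((gram s)⁻¹ *ᵥ (Aᵀ *ᵥ (A.col j - A.col k))))⁻¹ =
      dualCombination (normalizedDirection (Aᵀ *ᵥ (A.col j - A.col k))) s ⬝ᵥ z -
        A.col k ⬝ᵥ (A.col k - A.col j) *
        (dualCombination (normalizedDirection (Aᵀ *ᵥ (A.col j - A.col k))) s ⬝ᵥ
          dualCombination (normalizedDirection (Aᵀ *ᵥ (A.col j - A.col k))) s) := by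
  have h0 := (dotProduct_gram_inv_pos hs hV).ne'
  rw [dualCombination_dotProduct_self hs, dualCombination_dotProduct, ← sub_dotProduct,
    stat_eq hs, dotProduct_add, Matrix.dotProduct_mulVec _ A, ← Matrix.mulVec_transpose]
  set V := Aᵀ *ᵥ (A.col j - A.col k)
  simp only [normalizedDirection, smul_dotProduct, Matrix.mulVec_smul, dotProduct_smul,
    smul_eq_mul]
  rw [inv_mul_cancel₀ h0, dotProduct_comm (A.col k), sub_dotProduct, sub_dotProduct]
  ring

lemma law_col_le_le (hMT : M ≤ T) (h𝓔 : 0 < 𝓔) (hσ : 0 < σ)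
    (hV : Aᵀ *ᵥ (A.col j - A.col k) ≠ 0) (hc : 0 ≤ A.col k ⬝ᵥ (A.col k - A.col j)) :
    law M T 𝓔 σ {ω | A.col k ⬝ᵥ stat A k ω.1 ω.2 ≤ A.col j ⬝ᵥ stat A k ω.1 ω.2} ≤
      ENNReal.ofReal ((1 + (A.col k ⬝ᵥ (A.col k - A.col j)) ^ 2 * snr 𝓔 σ /
        ((Aᵀ *ᵥ (A.col j - A.col k)) ⬝ᵥ (Aᵀ *ᵥ (A.col j - A.col k)))) ^
        (-(((T : ℝ) - M + 1) / 2))) := by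
  have hVV := dotProduct_self_pos hV
  have h := law_le_energy_le hMT h𝓔 hσ (smul_ne_zero (inv_ne_zero hVV.ne') hV)
    (fun k hk => by rw [smul_dotProduct, mem_hyperplane.1 hk, smul_zero])
    (measurable_dualCombination (measurable_normalizedDirection _))
    (isMinimalCombination_hyperplane hV) hc
  rw [finrank_hyperplane hV, smul_dotProduct, dotProduct_smul, smul_eq_mul, smul_eq_mul,
    inv_mul_cancel₀ hVV.ne', mul_one, ← div_eq_mul_inv, sub_sub_eq_add_sub,
    add_sub_right_comm] at h
  refine (measure_mono_ae ?_).trans h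
  filter_upwards [ae_law_linearIndependent hMT h𝓔 σ] with ω hω hle
  have hle' : A.col k ⬝ᵥ stat A k ω.1 ω.2 ≤ A.col j ⬝ᵥ stat A k ω.1 ω.2 := hle
  have := col_dotProduct_stat_sub hω hV ω.2
  have h2 := mul_nonneg (sub_nonneg.2 hle') (inv_nonneg.2 (dotProduct_gram_inv_pos hω hV).le)
  rw [this, sub_nonneg] at h2
  exact h2

lemma le_law_col_lt (hMT : M ≤ T) (h𝓔 : 0 < 𝓔) (hσ : 0 < σ)
    (hV : Aᵀ *ᵥ (A.col j - A.col k) ≠ 0) (hc : 0 ≤ A.col k ⬝ᵥ (A.col k - A.col j))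
    {ε : ℝ} (hε : 0 < ε) :
    ENNReal.ofReal ((√(2 * Real.pi))⁻¹ * Real.exp (-((1 + 1 / ε) / 2)) *
      (1 + (1 + ε) * (A.col k ⬝ᵥ (A.col k - A.col j)) ^ 2 * snr 𝓔 σ /
        ((Aᵀ *ᵥ (A.col j - A.col k)) ⬝ᵥ (Aᵀ *ᵥ (A.col j - A.col k)))) ^
        (-(((T : ℝ) - M + 1) / 2))) ≤
    law M T 𝓔 σ {ω | A.col k ⬝ᵥ stat A k ω.1 ω.2 < A.col j ⬝ᵥ stat A k ω.1 ω.2} := by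
  have hVV := dotProduct_self_pos hV
  have h := le_law_energy_lt hMT h𝓔 hσ (smul_ne_zero (inv_ne_zero hVV.ne') hV)
    (fun k hk => by rw [smul_dotProduct, mem_hyperplane.1 hk, smul_zero])
    (measurable_dualCombination (measurable_normalizedDirection _))
    (isMinimalCombination_hyperplane hV) hc hε
  rw [finrank_hyperplane hV, smul_dotProduct, dotProduct_smul, smul_eq_mul, smul_eq_mul,
    inv_mul_cancel₀ hVV.ne', mul_one, ← div_eq_mul_inv, sub_sub_eq_add_sub,
    add_sub_right_comm] at h
  refine h.trans (measure_mono_ae ?_)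
  filter_upwards [ae_law_linearIndependent hMT h𝓔 σ] with ω hω hlt
  have := col_dotProduct_stat_sub hω hV ω.2
  have h2 : 0 < (A.col j ⬝ᵥ stat A k ω.1 ω.2 - A.col k ⬝ᵥ stat A k ω.1 ω.2) *
        ((Aᵀ *ᵥ (A.col j - A.col k)) ⬝ᵥ ((gram ω.1)⁻¹ *ᵥ (Aᵀ *ᵥ (A.col j - A.col k))))⁻¹ := by
    rw [this, sub_pos]
    exact hlt
  exact sub_pos.1 (pos_of_mul_pos_left h2 (inv_nonneg.2 (dotProduct_gram_inv_pos hω hV).le))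

end ReducedDimensionality

/-! ### Pairwise errors of the maximum likelihood detector. -/

section MaximumLikelihood

variable {M N T : ℕ} {𝓔 σ τ : ℝ} {A : Matrix (Fin N) (Fin M) ℝ}

/-- The covariance matrix of the approximate sufficient statistic, for noise of variance `1`. -/
noncomputable def statCov (A : Matrix (Fin N) (Fin M) ℝ) (s : Fin M → Fin T → ℝ) :
    Matrix (Fin N) (Fin N) ℝ :=
  A * (gram s)⁻¹ * Aᵀ

lemma mulVec_transpose_mulVec (hA : A * Aᵀ = τ • 1) (w : Fin N → ℝ) :
    A *ᵥ (Aᵀ *ᵥ w) = τ • w := by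
  rw [Matrix.mulVec_mulVec, hA, Matrix.smul_mulVec, Matrix.one_mulVec]

lemma statCov_posDef (hA : A * Aᵀ = τ • 1) (hτ : 0 < τ) {s : Fin M → Fin T → ℝ}
    (hs : LinearIndependent ℝ s) : (statCov A s).PosDef := by
  have h := (gram_posDef hs).inv.mul_mul_conjTranspose_same (B := A) ?_
  · simpa [statCov, Matrix.conjTranspose_eq_transpose_of_trivial] using h
  · intro w w' hww'
    have h1 : Aᵀ *ᵥ w = Aᵀ *ᵥ w' := by
      simpa only [Matrix.mulVec_transpose] using hww'
    have h2 := congrArg (A *ᵥ ·) h1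
    simp only [mulVec_transpose_mulVec hA] at h2
    exact smul_right_injective _ hτ.ne' h2

/-- The vector `Aᵀ (A G⁻¹ Aᵀ)⁻¹ w`. -/
noncomputable def whitenedDirection (A : Matrix (Fin N) (Fin M) ℝ) (w : Fin N → ℝ)
    (s : Fin M → Fin T → ℝ) : Fin M → ℝ :=
  Aᵀ *ᵥ ((statCov A s)⁻¹ *ᵥ w)

lemma measurable_whitenedDirection (A : Matrix (Fin N) (Fin M) ℝ) (w : Fin N → ℝ) :
    Measurable (whitenedDirection (T := T) A w) := by
  have h1 : ∀ i j, Measurable fun s : Fin M → Fin T → ℝ => (statCov A s) i j := by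
    intro i j
    simp only [statCov, Matrix.mul_apply]
    refine Finset.measurable_sum _ fun a _ => (Finset.measurable_sum _ fun b _ => ?_).mul_const _
    exact (measurable_gram_inv b a).const_mul _
  have h2 := measurable_matrix_inv h1
  refine measurable_pi_iff.2 fun m => ?_
  simp only [whitenedDirection, Matrix.mulVec, dotProduct]
  exact Finset.measurable_sum _ fun i _ => (Finset.measurable_sum _ fun j _ =>
    (h2 i j).mul_const _).const_mul _

lemma finrank_ker_mulVecLin (hA : A * Aᵀ = τ • 1) (hτ : 0 < τ) :
    (Module.finrank ℝ (LinearMap.ker A.mulVecLin) : ℝ) = M - N := by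
  have h := A.mulVecLin.finrank_range_add_finrank_ker
  have hsurj : LinearMap.range A.mulVecLin = ⊤ := by
    rw [LinearMap.range_eq_top]
    intro w
    refine ⟨τ⁻¹ • (Aᵀ *ᵥ w), ?_⟩
    rw [map_smul, Matrix.mulVecLin_apply, mulVec_transpose_mulVec hA, inv_smul_smul₀ hτ.ne']
  rw [hsurj, finrank_top, Module.finrank_fin_fun, Module.finrank_fin_fun] at h
  rw [eq_sub_iff_add_eq, add_comm]
  exact mod_cast h

/-- Both `G⁻¹ Aᵀ (A G⁻¹ Aᵀ)⁻¹ w` and `τ⁻¹ Aᵀ w` solve `A x = w`, so they differ by an element of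
`ker A`; the second is the solution orthogonal to `ker A`. -/
lemma isMinimalCombination_ker (hA : A * Aᵀ = τ • 1) (hτ : 0 < τ) (w : Fin N → ℝ) :
    IsMinimalCombination (T := T) (LinearMap.ker A.mulVecLin) (τ⁻¹ • (Aᵀ *ᵥ w))
      (dualCombination (whitenedDirection A w)) := by
  refine isMinimalCombination_dualCombination fun s hs => ⟨?_, fun k hk => ?_⟩
  · rw [LinearMap.mem_ker, map_sub, map_smul, Matrix.mulVecLin_apply, Matrix.mulVecLin_apply,
      mulVec_transpose_mulVec hA, inv_smul_smul₀ hτ.ne', sub_eq_zero, whitenedDirection,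
      Matrix.mulVec_mulVec, Matrix.mulVec_mulVec, Matrix.mulVec_mulVec, ← statCov,
      Matrix.mul_nonsing_inv _ (statCov_posDef hA hτ hs).det_pos.ne'.isUnit, Matrix.one_mulVec]
  · rw [LinearMap.mem_ker, Matrix.mulVecLin_apply] at hk
    rw [whitenedDirection, dotProduct_comm, Matrix.dotProduct_mulVec, Matrix.vecMul_transpose, hk,
      zero_dotProduct]

/-- The normalizing determinant is common to all hypotheses, so densities compare through the
quadratic form `Q = (A G⁻¹ Aᵀ)⁻¹`. The comparison reads `½ w ⬝ Q w ≤ w ⬝ Q n`, where `n` is the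
noise part of `u`; the two sides are half the energy of the whitened combination and its scalar
product with `z`. -/
lemma le_dotProduct_of_condDensity_le (hσ : 0 < σ) (hA : A * Aᵀ = τ • 1) (hτ : 0 < τ)
    {s : Fin M → Fin T → ℝ} (hs : LinearIndependent ℝ s) {j k : Fin M} {z : Fin T → ℝ}
    (h : condDensity σ A (gram s) k (stat A k s z) ≤ condDensity σ A (gram s) j (stat A k s z)) :
    1 / 2 * (dualCombination (whitenedDirection A (A.col j - A.col k)) s ⬝ᵥ
        dualCombination (whitenedDirection A (A.col j - A.col k)) s) ≤
      dualCombination (whitenedDirection A (A.col j - A.col k)) s ⬝ᵥ z := by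
  have hpos := statCov_posDef hA hτ hs
  have hdet := hpos.det_pos
  have hunit := hdet.ne'.isUnit
  set Q := (statCov A s)⁻¹ with hQ
  have hQT : Qᵀ = Q := by
    have := hpos.inv.isHermitian
    rwa [Matrix.IsHermitian, Matrix.conjTranspose_eq_transpose_of_trivial] at this
  have hinv : (σ ^ 2 • statCov A s)⁻¹ = (σ ^ 2)⁻¹ • Q := by
    refine Matrix.inv_eq_left_inv ?_
    rw [Matrix.smul_mul, Matrix.mul_smul, smul_smul, inv_mul_cancel₀ (by positivity), one_smul,
      hQ, Matrix.nonsing_inv_mul _ hunit]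
  set n := A *ᵥ ((gram s)⁻¹ *ᵥ ((Matrix.of s : Matrix _ _ ℝ) *ᵥ z)) with hn
  set w := A.col j - A.col k with hw
  have hD : 0 < Real.sqrt ((2 * Real.pi) ^ N * (σ ^ 2 • statCov A s).det) := by
    rw [Matrix.det_smul]
    positivity
  have hk : stat A k s z - A.col k = n := by rw [stat_eq hs, add_sub_cancel_left]
  have hj : stat A k s z - A.col j = n - w := by rw [stat_eq hs, hw, hn]; abel
  unfold condDensity at h
  rw [← statCov, div_le_div_iff_of_pos_right hD, Real.exp_le_exp, hk, hj, hinv] at h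
  simp only [Matrix.smul_mulVec, dotProduct_smul, smul_eq_mul, Matrix.mulVec_sub, dotProduct_sub,
    sub_dotProduct] at h
  have hsymm : n ⬝ᵥ Q *ᵥ w = w ⬝ᵥ Q *ᵥ n := by
    rw [Matrix.dotProduct_mulVec, ← Matrix.mulVec_transpose, hQT, dotProduct_comm]
  rw [hsymm] at h
  have h3 : 1 / 2 * (w ⬝ᵥ Q *ᵥ w) ≤ w ⬝ᵥ Q *ᵥ n := by
    have hσ2 : 0 < (σ ^ 2)⁻¹ := by positivity
    have : 0 ≤ (σ ^ 2)⁻¹ * (w ⬝ᵥ Q *ᵥ n - 1 / 2 * (w ⬝ᵥ Q *ᵥ w)) := by linarith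
    linarith [nonneg_of_mul_nonneg_right this hσ2]
  have hY : ∀ y, whitenedDirection A w s ⬝ᵥ y = w ⬝ᵥ Q *ᵥ (A *ᵥ y) := by
    intro y
    rw [whitenedDirection, dotProduct_comm, Matrix.dotProduct_mulVec, Matrix.vecMul_transpose,
      Matrix.dotProduct_mulVec, ← Matrix.mulVec_transpose, ← hQ, hQT, dotProduct_comm]
  rw [dualCombination_dotProduct_self hs, dualCombination_dotProduct, hY, hY, ← hn]
  have hQw : A *ᵥ ((gram s)⁻¹ *ᵥ whitenedDirection A w s) = w := by
    rw [whitenedDirection, Matrix.mulVec_mulVec, Matrix.mulVec_mulVec, Matrix.mulVec_mulVec,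
      ← statCov, Matrix.mul_nonsing_inv _ hunit, Matrix.one_mulVec]
  rwa [hQw]

lemma law_condDensity_le_le (hMT : M ≤ T) (h𝓔 : 0 < 𝓔) (hσ : 0 < σ)
    (hA : A * Aᵀ = τ • 1) (hτ : 0 < τ) {j k : Fin M} (hjk : A.col j ≠ A.col k) :
    law M T 𝓔 σ {ω | condDensity σ A (gram ω.1) k (stat A k ω.1 ω.2) ≤
        condDensity σ A (gram ω.1) j (stat A k ω.1 ω.2)} ≤
      ENNReal.ofReal ((1 + snr 𝓔 σ * ((A.col j - A.col k) ⬝ᵥ (A.col j - A.col k)) / (4 * τ)) ^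
        (-(((T : ℝ) - M + N) / 2))) := by
  set w := A.col j - A.col k with hw
  have hw0 : w ≠ 0 := sub_ne_zero.2 hjk
  have hAw : Aᵀ *ᵥ w ≠ 0 := by
    intro h0
    have := mulVec_transpose_mulVec hA w
    rw [h0, Matrix.mulVec_zero] at this
    exact smul_ne_zero hτ.ne' hw0 this.symm
  have hdot : ∀ k, (Aᵀ *ᵥ w) ⬝ᵥ k = w ⬝ᵥ A *ᵥ k := by
    intro k
    rw [dotProduct_comm, Matrix.dotProduct_mulVec, Matrix.vecMul_transpose, dotProduct_comm]
  have h := law_le_energy_le hMT h𝓔 hσ (smul_ne_zero (inv_ne_zero hτ.ne') hAw)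
    (fun k hk => by
      rw [LinearMap.mem_ker, Matrix.mulVecLin_apply] at hk
      rw [smul_dotProduct, hdot, hk, dotProduct_zero, smul_zero])
    (measurable_dualCombination (measurable_whitenedDirection A w))
    (isMinimalCombination_ker hA hτ w) (c := 1 / 2) (by norm_num)
  rw [finrank_ker_mulVecLin hA hτ, smul_dotProduct, dotProduct_smul, smul_eq_mul, smul_eq_mul,
    hdot, mulVec_transpose_mulVec hA, dotProduct_smul, smul_eq_mul, inv_mul_cancel_left₀ hτ.ne',
    sub_sub_eq_add_sub, add_sub_right_comm] at h
  have heq : snr 𝓔 σ * (w ⬝ᵥ w) / (4 * τ) = (1 / 2) ^ 2 * snr 𝓔 σ * (τ⁻¹ * w ⬝ᵥ w) := by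
    field_simp
    norm_num
  rw [heq]
  refine (measure_mono_ae ?_).trans h
  filter_upwards [ae_law_linearIndependent hMT h𝓔 σ] with ω hω hle
  exact le_dotProduct_of_condDensity_le hσ hA hτ hω hle

end MaximumLikelihood

/-! ### Union bound and averaging over hypotheses. -/

section UnionBound

variable {M N T : ℕ} {𝓔 σ : ℝ} {A : Matrix (Fin N) (Fin M) ℝ}

/-- Monotonicity and subadditivity of the outer measure suffice, so arbitrary tie-breaking,
measurable or not, is allowed. -/
lemma errProb_le_of_pairwise {ψ : Matrix (Fin M) (Fin M) ℝ → (Fin N → ℝ) → Fin M} {k : Fin M}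
    {E : Fin M → Set ((Fin M → Fin T → ℝ) × (Fin T → ℝ))} {B : ℝ≥0∞}
    (hE : ∀ ω j, ψ (gram ω.1) (stat A k ω.1 ω.2) = j → ω ∈ E j)
    (hB : ∀ j, j ≠ k → law M T 𝓔 σ (E j) ≤ B) :
    errProb T 𝓔 σ A ψ k ≤ M * B := by
  calc errProb T 𝓔 σ A ψ k ≤ law M T 𝓔 σ (⋃ j ∈ Finset.univ.erase k, E j) := by
        refine measure_mono fun ω hω => ?_
        simp only [Set.mem_iUnion]
        exact ⟨_, Finset.mem_erase.2 ⟨hω, Finset.mem_univ _⟩, hE ω _ rfl⟩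
    _ ≤ ∑ j ∈ Finset.univ.erase k, law M T 𝓔 σ (E j) := measure_biUnion_finset_le _ _
    _ ≤ ∑ j ∈ Finset.univ.erase k, B :=
        Finset.sum_le_sum fun j hj => hB j (Finset.ne_of_mem_erase hj)
    _ ≤ M * B := by
        rw [Finset.sum_const, nsmul_eq_mul]
        gcongr
        exact (Finset.card_le_univ _).trans_eq (Fintype.card_fin M)

lemma avgErrProb_le {ψ : Matrix (Fin M) (Fin M) ℝ → (Fin N → ℝ) → Fin M} {B : ℝ≥0∞}
    (hB : ∀ k, errProb T 𝓔 σ A ψ k ≤ B) : avgErrProb T 𝓔 σ A ψ ≤ B := by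
  refine ENNReal.div_le_of_le_mul ?_
  refine (Finset.sum_le_sum fun k _ => hB k).trans_eq ?_
  simp [mul_comm]

lemma le_avgErrProb (hM : M ≠ 0) {ψ : Matrix (Fin M) (Fin M) ℝ → (Fin N → ℝ) → Fin M}
    {B : ℝ≥0∞} (hB : ∀ k, B ≤ errProb T 𝓔 σ A ψ k) : B ≤ avgErrProb T 𝓔 σ A ψ := by
  rw [avgErrProb, ENNReal.le_div_iff_mul_le (by simp [hM]) (by simp)]
  refine le_trans (Eq.le ?_) (Finset.sum_le_sum fun k _ => hB k)
  simp [mul_comm]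

end UnionBound

/-! ### Error bounds at finite size for incoherent frames. -/

section FiniteSize

variable {M N T : ℕ} {𝓔 σ τ δ : ℝ} {A : Matrix (Fin N) (Fin M) ℝ}

/-- The columns of `A` are unit vectors of mutual coherence at most `δ`. -/
structure IsIncoherent (A : Matrix (Fin N) (Fin M) ℝ) (δ : ℝ) : Prop where
  normalized : ∀ k, A.col k ⬝ᵥ A.col k = 1
  coherence_le : ∀ j k, j ≠ k → |A.col j ⬝ᵥ A.col k| ≤ δ

/-- `τ` is an upper frame bound for the columns of `A`. -/
def HasFrameBound (A : Matrix (Fin N) (Fin M) ℝ) (τ : ℝ) : Prop :=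
  ∀ w, (Aᵀ *ᵥ w) ⬝ᵥ (Aᵀ *ᵥ w) ≤ τ * (w ⬝ᵥ w)

lemma transpose_mulVec_dotProduct_self (hA : A * Aᵀ = τ • 1) (w : Fin N → ℝ) :
    (Aᵀ *ᵥ w) ⬝ᵥ (Aᵀ *ᵥ w) = τ * (w ⬝ᵥ w) := by
  rw [Matrix.dotProduct_mulVec, Matrix.vecMul_transpose, mulVec_transpose_mulVec hA,
    smul_dotProduct, smul_eq_mul]

lemma hasFrameBound_of_mul_transpose (hA : A * Aᵀ = τ • 1) : HasFrameBound A τ :=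
  fun w => (transpose_mulVec_dotProduct_self hA w).le

namespace IsIncoherent

lemma col_dotProduct_sub (hA : IsIncoherent A δ) (j k : Fin M) :
    A.col k ⬝ᵥ (A.col k - A.col j) = 1 - A.col j ⬝ᵥ A.col k := by
  rw [dotProduct_sub, hA.normalized, dotProduct_comm (A.col k)]

lemma sub_dotProduct_sub (hA : IsIncoherent A δ) (j k : Fin M) :
    (A.col j - A.col k) ⬝ᵥ (A.col j - A.col k) = 2 * (1 - A.col j ⬝ᵥ A.col k) := by
  rw [dotProduct_sub, sub_dotProduct, sub_dotProduct, hA.normalized, hA.normalized,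
    dotProduct_comm (A.col k)]
  ring

lemma one_sub_pos (hA : IsIncoherent A δ) (hδ : δ < 1) {j k : Fin M} (hjk : j ≠ k) :
    0 < 1 - A.col j ⬝ᵥ A.col k := by
  linarith [(abs_le.1 (hA.coherence_le j k hjk)).2]

lemma transpose_mulVec_ne_zero (hA : IsIncoherent A δ) (hδ : δ < 1) {j k : Fin M} (hjk : j ≠ k) :
    Aᵀ *ᵥ (A.col j - A.col k) ≠ 0 := by
  intro h
  have h1 : A.col k ⬝ᵥ (A.col j - A.col k) = 0 := congrFun h k
  rw [← neg_sub, dotProduct_neg, hA.col_dotProduct_sub] at h1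
  linarith [hA.one_sub_pos hδ hjk]

end IsIncoherent

lemma rpow_neg_le_rpow_neg {a b e : ℝ} (ha : 0 ≤ a) (hab : a ≤ b) (he : 0 ≤ e) :
    (1 + b) ^ (-e) ≤ (1 + a) ^ (-e) :=
  Real.rpow_le_rpow_of_nonpos (by positivity) (by linarith) (by linarith)

lemma snr_pos (h𝓔 : 0 < 𝓔) (hσ : 0 < σ) : 0 < snr 𝓔 σ := by
  unfold snr
  positivity

lemma errProb_rdd_le (hMT : M ≤ T) (h𝓔 : 0 < 𝓔) (hσ : 0 < σ) (hA : IsIncoherent A δ)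
    (hδ : δ < 1) (hτ : 0 < τ) (hAτ : HasFrameBound A τ) {φ : (Fin N → ℝ) → Fin M}
    (hφ : IsModifiedRDD A φ) (k : Fin M) :
    errProb T 𝓔 σ A (fun _ => φ) k ≤
      M * ENNReal.ofReal ((1 + (1 - δ) * snr 𝓔 σ / (2 * τ)) ^ (-(((T : ℝ) - M + 1) / 2))) := by
  have hMT' : (M : ℝ) ≤ T := mod_cast hMT
  have hsnr := snr_pos h𝓔 hσ
  refine errProb_le_of_pairwise (E := fun j => {ω | A.col k ⬝ᵥ stat A k ω.1 ω.2 ≤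
    A.col j ⬝ᵥ stat A k ω.1 ω.2}) ?_ ?_
  · rintro ω j rfl
    exact hφ _ k
  · intro j hjk
    have hpos := hA.one_sub_pos hδ hjk
    have hV := dotProduct_self_pos (hA.transpose_mulVec_ne_zero hδ hjk)
    have hVle := hAτ (A.col j - A.col k)
    refine (law_col_le_le hMT h𝓔 hσ (hA.transpose_mulVec_ne_zero hδ hjk) ?_).trans
      (ENNReal.ofReal_le_ofReal (rpow_neg_le_rpow_neg ?_ ?_ (by linarith)))
    · rw [hA.col_dotProduct_sub]
      exact hpos.le
    · have : 0 ≤ 1 - δ := by linarith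
      positivity
    · rw [hA.sub_dotProduct_sub] at hVle
      rw [hA.col_dotProduct_sub, div_le_div_iff₀ (by positivity) hV]
      have hδ' : 1 - δ ≤ 1 - A.col j ⬝ᵥ A.col k := by
        linarith [(abs_le.1 (hA.coherence_le j k hjk)).2]
      -- With unit columns `|a_j - a_k|² = 2c`, hence `|V|² ≤ 2cτ`, and the gain `c² / |V|²` is at
      -- least `c / (2τ) ≥ (1 - δ) / (2τ)`.
      set c := 1 - A.col j ⬝ᵥ A.col k
      calc (1 - δ) * snr 𝓔 σ * _ ≤ (1 - δ) * snr 𝓔 σ * (τ * (2 * c)) := by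
            have : 0 ≤ 1 - δ := by linarith
            gcongr
        _ ≤ c * snr 𝓔 σ * (τ * (2 * c)) := by gcongr
        _ = c ^ 2 * snr 𝓔 σ * (2 * τ) := by ring

/-- One competitor with a strictly larger score already forces an error. The tight frame identity
makes `|V|² = 2cτ` exact, which bounds the gain from above. -/
lemma le_errProb_rdd (hMT : M ≤ T) (hM : 2 ≤ M) (h𝓔 : 0 < 𝓔) (hσ : 0 < σ)
    (hA : IsIncoherent A δ) (hδ : δ < 1) (hτ : 0 < τ) (hAτ : A * Aᵀ = τ • 1)
    {φ : (Fin N → ℝ) → Fin M} (hφ : IsModifiedRDD A φ) (k : Fin M) {ε : ℝ} (hε : 0 < ε) :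
    ENNReal.ofReal ((√(2 * Real.pi))⁻¹ * Real.exp (-((1 + 1 / ε) / 2)) *
      (1 + (1 + ε) * (1 + δ) * snr 𝓔 σ / (2 * τ)) ^ (-(((T : ℝ) - M + 1) / 2))) ≤
      errProb T 𝓔 σ A (fun _ => φ) k := by
  have hMT' : (M : ℝ) ≤ T := mod_cast hMT
  have hsnr := snr_pos h𝓔 hσ
  have : Nontrivial (Fin M) := Fin.nontrivial_iff_two_le.2 hM
  obtain ⟨j, hjk⟩ := exists_ne k
  have hpos := hA.one_sub_pos hδ hjk
  have hV := dotProduct_self_pos (hA.transpose_mulVec_ne_zero hδ hjk)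
  have h := le_law_col_lt hMT h𝓔 hσ (hA.transpose_mulVec_ne_zero hδ hjk)
    (by rw [hA.col_dotProduct_sub]; exact hpos.le) hε
  refine le_trans (ENNReal.ofReal_le_ofReal ?_) (h.trans (measure_mono fun ω hω => ?_))
  · refine mul_le_mul_of_nonneg_left (rpow_neg_le_rpow_neg (by positivity) ?_ (by linarith))
      (by positivity)
    rw [transpose_mulVec_dotProduct_self hAτ, hA.sub_dotProduct_sub, hA.col_dotProduct_sub]
    have hδ' : 1 - A.col j ⬝ᵥ A.col k ≤ 1 + δ := by
      linarith [(abs_le.1 (hA.coherence_le j k hjk)).1]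
    set c := 1 - A.col j ⬝ᵥ A.col k
    have : (1 + ε) * c ^ 2 * snr 𝓔 σ / (τ * (2 * c)) = (1 + ε) * c * snr 𝓔 σ / (2 * τ) := by
      field_simp
    rw [this]
    gcongr
  · intro hk
    have h1 : φ (stat A k ω.1 ω.2) = k := hk
    have h2 := hφ (stat A k ω.1 ω.2) j
    rw [h1] at h2
    exact not_lt.2 h2 hω

lemma errProb_ml_le (hMT : M ≤ T) (h𝓔 : 0 < 𝓔) (hσ : 0 < σ)
    (hA : IsIncoherent A δ) (hδ : δ < 1) (hτ : 0 < τ) (hAτ : A * Aᵀ = τ • 1)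
    {ψ : Matrix (Fin M) (Fin M) ℝ → (Fin N → ℝ) → Fin M} (hψ : IsMLDetector σ A ψ) (k : Fin M) :
    errProb T 𝓔 σ A ψ k ≤
      M * ENNReal.ofReal ((1 + (1 - δ) * snr 𝓔 σ / (2 * τ)) ^ (-(((T : ℝ) - M + N) / 2))) := by
  have hMT' : (M : ℝ) ≤ T := mod_cast hMT
  have hsnr := snr_pos h𝓔 hσ
  refine errProb_le_of_pairwise (E := fun j => {ω | condDensity σ A (gram ω.1) k
    (stat A k ω.1 ω.2) ≤ condDensity σ A (gram ω.1) j (stat A k ω.1 ω.2)}) ?_ ?_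
  · rintro ω j rfl
    exact hψ _ _ k
  · intro j hjk
    have hpos := hA.one_sub_pos hδ hjk
    have hne : A.col j ≠ A.col k := by
      intro h
      apply hA.transpose_mulVec_ne_zero hδ hjk
      rw [h, sub_self, Matrix.mulVec_zero]
    refine (law_condDensity_le_le hMT h𝓔 hσ hAτ hτ hne).trans
      (ENNReal.ofReal_le_ofReal (rpow_neg_le_rpow_neg ?_ ?_ ?_))
    · have : 0 ≤ 1 - δ := by linarith
      positivity
    · rw [hA.sub_dotProduct_sub]
      have hδ' : 1 - δ ≤ 1 - A.col j ⬝ᵥ A.col k := by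
        linarith [(abs_le.1 (hA.coherence_le j k hjk)).2]
      set c := 1 - A.col j ⬝ᵥ A.col k
      have : snr 𝓔 σ * (2 * c) / (4 * τ) = c * snr 𝓔 σ / (2 * τ) := by
        field_simp
        norm_num
      rw [this]
      gcongr
    · have : (0 : ℝ) ≤ N := N.cast_nonneg
      linarith

end FiniteSize

/-! ### Exponential rates of the finite-size bounds. -/

section Rate

lemma rate_eq_of_pos (M : ℕ+) {x : ℝ} (hx : 0 < x) :
    rate M (ENNReal.ofReal x) = ((-Real.log x / (M : ℕ) : ℝ) : EReal) := by
  rw [rate, ENNReal.log_ofReal_of_pos hx, EReal.coe_div, EReal.coe_neg]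
  rfl

lemma rate_anti (M : ℕ+) : Antitone (rate M) := fun p q hpq =>
  EReal.div_le_div_right_of_nonneg (by positivity) (EReal.neg_le_neg_iff.2 (ENNReal.log_monotone hpq))

variable {ι : Type*} {l : Filter ι} {m : ι → ℕ+} {T : ι → ℕ} {q r : ι → ℝ} {β θ ρ : ℝ}

lemma tendsto_coe_atTop (hm : Tendsto m l atTop) :
    Tendsto (fun n => ((m n : ℕ) : ℝ)) l atTop :=
  tendsto_natCast_atTop_atTop.comp (tendsto_PNat_val_atTop_atTop.comp hm)

lemma tendsto_rate_exponent (hT : Tendsto (fun n => (T n : ℝ) / (m n : ℕ)) l (𝓝 β))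
    (hq : Tendsto (fun n => q n / (m n : ℕ)) l (𝓝 θ)) (hr : Tendsto r l (𝓝 ρ)) (hρ : 0 < ρ) :
    Tendsto (fun n => ((T n : ℝ) - (m n : ℕ) + q n) / 2 * Real.log (1 + r n) / (m n : ℕ)) l
      (𝓝 ((β - 1 + θ) / 2 * Real.log (1 + ρ))) := by
  have h1 : Tendsto (fun n => ((T n : ℝ) / (m n : ℕ) - 1 + q n / (m n : ℕ)) / 2 *
      Real.log (1 + r n)) l (𝓝 ((β - 1 + θ) / 2 * Real.log (1 + ρ))) :=
    (((hT.sub_const 1).add hq).div_const 2).mul ((hr.const_add 1).log (by positivity))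
  refine h1.congr fun n => ?_
  have : ((m n : ℕ) : ℝ) ≠ 0 := by simp
  field_simp

lemma tendsto_rate_of_upper (hm : Tendsto m l atTop)
    (hT : Tendsto (fun n => (T n : ℝ) / (m n : ℕ)) l (𝓝 β))
    (hq : Tendsto (fun n => q n / (m n : ℕ)) l (𝓝 θ)) (hr : Tendsto r l (𝓝 ρ)) (hρ : 0 < ρ) :
    Tendsto (fun n => rate (m n) ((m n : ℕ) * ENNReal.ofReal
        ((1 + r n) ^ (-(((T n : ℝ) - (m n : ℕ) + q n) / 2))))) l
      (𝓝 (((β - 1 + θ) / 2 * Real.log (1 + ρ) : ℝ) : EReal)) := by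
  -- The cost of the union bound over `m n` competitors.
  have hlog : Tendsto (fun n => Real.log (m n : ℕ) / (m n : ℕ)) l (𝓝 0) :=
    (Real.isLittleO_log_id_atTop.tendsto_div_nhds_zero).comp (tendsto_coe_atTop hm)
  have h := (tendsto_rate_exponent hT hq hr hρ).sub hlog
  rw [sub_zero] at h
  refine (EReal.tendsto_coe.2 h).congr' ?_
  filter_upwards [hr.eventually (lt_mem_nhds hρ)] with n hn
  have hpos : 0 < 1 + r n := by linarith
  have hm0 : (0 : ℝ) < (m n : ℕ) := by simp
  rw [← ENNReal.ofReal_natCast, ← ENNReal.ofReal_mul (by positivity), rate_eq_of_pos _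
    (by positivity), Real.log_mul (by positivity) (by positivity), Real.log_rpow hpos]
  congr 1
  ring

/-- The choice `ε = 1/√M` balances two demands: `ε → 0`, as needed for the base, and a prefactor
cost of order `1/ε = √M`, negligible after division by `M`. -/
lemma tendsto_rate_of_lower (hm : Tendsto m l atTop)
    (hT : Tendsto (fun n => (T n : ℝ) / (m n : ℕ)) l (𝓝 β))
    (hq : Tendsto (fun n => q n / (m n : ℕ)) l (𝓝 θ)) (hr : Tendsto r l (𝓝 ρ)) (hρ : 0 < ρ) :
    Tendsto (fun n => rate (m n) (ENNReal.ofReal ((√(2 * Real.pi))⁻¹ *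
        Real.exp (-((1 + 1 / (√(m n : ℕ))⁻¹) / 2)) *
        (1 + r n) ^ (-(((T n : ℝ) - (m n : ℕ) + q n) / 2))))) l
      (𝓝 (((β - 1 + θ) / 2 * Real.log (1 + ρ) : ℝ) : EReal)) := by
  have hM := tendsto_coe_atTop hm
  have h1 : Tendsto (fun n => (Real.log √(2 * Real.pi) + 1 / 2) / (m n : ℕ)) l (𝓝 0) :=
    tendsto_const_nhds.div_atTop hM
  have h2 : Tendsto (fun n => (1 / 2) / √(m n : ℕ)) l (𝓝 0) :=
    tendsto_const_nhds.div_atTop (Real.tendsto_sqrt_atTop.comp hM)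
  have h := ((tendsto_rate_exponent hT hq hr hρ).add h1).add h2
  rw [add_zero, add_zero] at h
  refine (EReal.tendsto_coe.2 h).congr' ?_
  filter_upwards [hr.eventually (lt_mem_nhds hρ)] with n hn
  have hpos : 0 < 1 + r n := by linarith
  have hm0 : (0 : ℝ) < (m n : ℕ) := by simp
  rw [rate_eq_of_pos _ (by positivity), Real.log_mul (by positivity) (by positivity),
    Real.log_mul (by positivity) (by positivity), Real.log_rpow hpos, Real.log_exp, Real.log_inv]
  congr 1
  have hs : √(m n : ℕ) ≠ 0 := by positivity
  have h3 : (1 / 2) / √(m n : ℕ) = √(m n : ℕ) / 2 / (m n : ℕ) := by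
    rw [div_eq_div_iff hs hm0.ne']
    linarith [Real.mul_self_sqrt hm0.le]
  have h4 : 1 / (√(m n : ℕ))⁻¹ = √(m n : ℕ) := by simp
  rw [h3, h4]
  ring

end Rate

/-! ### Additive character sums over multiplicative subgroups in characteristic two. -/

section TraceSign

variable {F : Type*} [Field F] [Algebra (ZMod 2) F]

/-- The additive character `(-1) ^ Tr` of a finite field of characteristic two. -/
noncomputable def traceSign (y : F) : ℝ := (-1) ^ (Algebra.trace (ZMod 2) F y).val

lemma traceSign_zero : traceSign (0 : F) = 1 := by simp [traceSign]

lemma traceSign_add (x y : F) : traceSign (x + y) = traceSign x * traceSign y := by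
  have h : ∀ a b : ZMod 2, (a + b).val % 2 = (a.val + b.val) % 2 := by decide
  rw [traceSign, traceSign, traceSign, map_add, ← pow_add, neg_one_pow_eq_pow_mod_two, h,
    ← neg_one_pow_eq_pow_mod_two]

lemma traceSign_mul_self (x : F) : traceSign x * traceSign x = 1 := by
  rw [traceSign, ← mul_pow]
  simp

variable [Finite F]

lemma exists_traceSign_eq_neg_one {c : F} (hc : c ≠ 0) : ∃ y, traceSign (c * y) = -1 := by
  obtain ⟨b, hb⟩ := Algebra.trace_surjective (ZMod 2) F 1
  refine ⟨c⁻¹ * b, ?_⟩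
  rw [mul_inv_cancel_left₀ hc, traceSign, hb]
  simp [ZMod.val_one]

variable {ι : Type*} [Fintype ι]

/-- Translation by a `y` where the character takes the value `-1` permutes the field and negates the
sum. -/
lemma sum_traceSign_mul (x : ι ≃ F) {c : F} (hc : c ≠ 0) : ∑ j, traceSign (c * x j) = 0 := by
  obtain ⟨y, hy⟩ := exists_traceSign_eq_neg_one hc
  have h : ∑ j, traceSign (c * x j) = ∑ j, traceSign (c * x j) * (-1) := by
    rw [← Equiv.sum_comp ((x.trans (Equiv.addRight y)).trans x.symm)]
    refine Finset.sum_congr rfl fun j _ => ?_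
    simp [mul_add, traceSign_add, hy]
  rw [← Finset.sum_mul] at h
  linarith

variable [CharP F 2]

lemma sum_traceSign_mul_traceSign [DecidableEq F] (x : ι ≃ F) (a b : F) :
    ∑ j, traceSign (a * x j) * traceSign (b * x j) = if a = b then (Fintype.card ι : ℝ) else 0 := by
  split_ifs with hab
  · subst hab
    simp [traceSign_mul_self]
  · simp_rw [← traceSign_add, ← add_mul]
    exact sum_traceSign_mul x (fun h => hab (CharTwo.add_eq_zero.1 h))

variable {ι' : Type*} [Fintype ι'] {H : Subgroup Fˣ}

lemma sum_sum_traceSign_sq (a : ι' ≃ H) (x : ι ≃ F) :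
    ∑ j, (∑ i, traceSign (((a i : Fˣ) : F) * x j)) ^ 2 = Fintype.card ι' * Fintype.card ι := by
  classical
  simp_rw [sq, Finset.sum_mul_sum]
  rw [Finset.sum_comm]
  have h : ∀ i, ∑ j, ∑ i', traceSign (((a i : Fˣ) : F) * x j) *
      traceSign (((a i' : Fˣ) : F) * x j) = Fintype.card ι := by
    intro i
    rw [Finset.sum_comm]
    simp_rw [sum_traceSign_mul_traceSign, Units.val_inj, Subtype.val_inj, a.injective.eq_iff]
    simp
  simp [h]

/-- The sum `S y` is constant on the coset `H y`, which has `|H|` elements, while the sum of `S²`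
over the field is `|H| |F|`; hence `S y ^ 2 ≤ |F|`. -/
lemma abs_sum_traceSign_le (a : ι' ≃ H) (x : ι ≃ F) {y : F} (hy : y ≠ 0) :
    |∑ i, traceSign (((a i : Fˣ) : F) * y)| ≤ √(Fintype.card ι) := by
  set S : F → ℝ := fun y => ∑ i, traceSign (((a i : Fˣ) : F) * y) with hS
  have hinv : ∀ i', S (((a i' : Fˣ) : F) * y) = S y := by
    intro i'
    rw [hS]
    simp only
    rw [← Equiv.sum_comp ((a.trans (Equiv.mulRight (a i'))).trans a.symm)
      (fun i => traceSign (((a i : Fˣ) : F) * y))]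
    refine Finset.sum_congr rfl fun i _ => ?_
    simp [mul_assoc]
  have hinj : Function.Injective fun i' => x.symm (((a i' : Fˣ) : F) * y) := by
    intro i j hij
    have := mul_right_cancel₀ hy (x.symm.injective hij)
    exact a.injective (Subtype.ext (Units.ext this))
  have hle : ∑ _i' : ι', S y ^ 2 ≤ ∑ j, S (x j) ^ 2 := by
    calc ∑ _i' : ι', S y ^ 2 = ∑ i' : ι', S (x (x.symm (((a i' : Fˣ) : F) * y))) ^ 2 := by
          simp [hinv]
      _ = ∑ j ∈ Finset.univ.map ⟨_, hinj⟩, S (x j) ^ 2 := by simp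
      _ ≤ ∑ j, S (x j) ^ 2 :=
          Finset.sum_le_sum_of_subset_of_nonneg (Finset.subset_univ _) fun _ _ _ => sq_nonneg _
  rw [sum_sum_traceSign_sq, Finset.sum_const, Finset.card_univ, nsmul_eq_mul] at hle
  have : Nonempty ι' := ⟨a.symm 1⟩
  have hpos : (0 : ℝ) < Fintype.card ι' := mod_cast Fintype.card_pos
  exact Real.abs_le_sqrt (le_of_mul_le_mul_left hle hpos)

end TraceSign

/-! ### Group Hadamard matrices: tight frame, coherence, existence. -/

section Hadamard

variable {M N : ℕ} {A : Matrix (Fin N) (Fin M) ℝ}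

lemma IsNormalizedGroupHadamard.two_le (hA : IsNormalizedGroupHadamard A) : 2 ≤ M := by
  obtain ⟨r, -, H, a, x, -⟩ := hA
  have := x.nontrivial
  exact Fin.nontrivial_iff_two_le.1 this

lemma IsNormalizedGroupHadamard.pos (hA : IsNormalizedGroupHadamard A) : 0 < N := by
  obtain ⟨r, -, H, a, x, -⟩ := hA
  exact (a.symm 1).pos

lemma IsNormalizedGroupHadamard.mul_transpose (hA : IsNormalizedGroupHadamard A) :
    A * Aᵀ = ((M : ℝ) / N) • 1 := by
  classical
  have hN : (0 : ℝ) < N := mod_cast hA.pos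
  obtain ⟨r, -, H, a, x, hA⟩ := hA
  ext i i'
  have h := sum_traceSign_mul_traceSign x ((a i : (GaloisField 2 r)ˣ) : GaloisField 2 r)
    ((a i' : (GaloisField 2 r)ˣ) : GaloisField 2 r)
  simp_rw [Units.val_inj, Subtype.val_inj, a.injective.eq_iff, Fintype.card_fin, traceSign] at h
  simp only [Matrix.mul_apply, Matrix.transpose_apply, hA, Matrix.smul_apply, Matrix.one_apply,
    mul_mul_mul_comm, ← Finset.mul_sum, h, smul_eq_mul]
  rw [← sq, div_pow, Real.sq_sqrt hN.le]
  split_ifs <;> ring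

lemma IsNormalizedGroupHadamard.isIncoherent (hA : IsNormalizedGroupHadamard A) :
    IsIncoherent A (√M / N) := by
  have hN : (0 : ℝ) < N := mod_cast hA.pos
  obtain ⟨r, -, H, a, x, hA⟩ := hA
  have hdot : ∀ j k, A.col j ⬝ᵥ A.col k =
      (∑ i, traceSign (((a i : (GaloisField 2 r)ˣ) : GaloisField 2 r) * (x j + x k))) / N := by
    intro j k
    simp only [dotProduct, Matrix.col_apply, hA, mul_mul_mul_comm, ← Finset.mul_sum, mul_add,
      traceSign_add]
    rw [← sq, div_pow, Real.sq_sqrt hN.le]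
    simp only [traceSign]
    ring
  refine ⟨fun k => ?_, fun j k hjk => ?_⟩
  · rw [hdot, CharTwo.add_self_eq_zero]
    simp [traceSign_zero, hN.ne']
  · rw [hdot, abs_div, abs_of_pos hN]
    gcongr
    have hne : x j + x k ≠ 0 := fun h => hjk (x.injective (CharTwo.add_eq_zero.1 h))
    simpa using abs_sum_traceSign_le a x hne

lemma exists_isHadamardSeq {α : ℝ} {κ : ℕ} (hκ : 1 / α = κ) (hodd : Odd κ) :
    ∃ (M : ℕ → ℕ+) (N : ℕ → ℕ) (A : ∀ n, Matrix (Fin (N n)) (Fin (M n)) ℝ),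
      IsHadamardSeq α M N A := by
  have hκ0 : 0 < κ := hodd.pos
  -- By Euler's theorem, which needs `κ` odd, `κ` divides `2 ^ r - 1` for these `r`; the cyclic
  -- group of units then has a subgroup of index `κ`.
  set r : ℕ → ℕ := fun n => κ.totient * (n + 1) with hr
  have hr0 : ∀ n, 0 < r n := fun n => Nat.mul_pos (Nat.totient_pos.2 hκ0) n.succ_pos
  have hrn : ∀ n, n ≤ r n := fun n =>
    n.le_succ.trans (Nat.le_mul_of_pos_left _ (Nat.totient_pos.2 hκ0))
  have hdvd : ∀ n, κ ∣ 2 ^ r n - 1 := by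
    intro n
    have h : 2 ^ κ.totient ≡ 1 [MOD κ] := Nat.ModEq.pow_totient (Nat.coprime_two_left.2 hodd)
    have h2 := h.pow (n + 1)
    rw [one_pow, ← pow_mul] at h2
    exact (Nat.modEq_iff_dvd' Nat.one_le_two_pow).1 h2.symm
  have hcard : ∀ n, Nat.card (GaloisField 2 (r n))ˣ = 2 ^ r n - 1 := by
    intro n
    rw [Nat.card_units, GaloisField.card 2 _ (hr0 n).ne']
  have hH : ∀ n, ∃ H : Subgroup (GaloisField 2 (r n))ˣ, Nat.card H = (2 ^ r n - 1) / κ := by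
    intro n
    obtain ⟨g, hg⟩ := IsCyclic.exists_ofOrder_eq_natCard (α := (GaloisField 2 (r n))ˣ)
    refine ⟨Subgroup.zpowers (g ^ κ), ?_⟩
    rw [Nat.card_zpowers, orderOf_pow_of_dvd hκ0.ne' (by rw [hg, hcard]; exact hdvd n), hg, hcard]
  choose H hH using hH
  have hN : ∀ n, Nonempty (Fin ((2 ^ r n - 1) / κ) ≃ H n) := fun n =>
    ⟨(Finite.equivFinOfCardEq (hH n)).symm⟩
  have hM : ∀ n, Nonempty (Fin (2 ^ r n) ≃ GaloisField 2 (r n)) := fun n =>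
    ⟨(Finite.equivFinOfCardEq (GaloisField.card 2 _ (hr0 n).ne')).symm⟩
  have a := fun n => (hN n).some
  have x := fun n => (hM n).some
  refine ⟨fun n => ⟨2 ^ r n, by positivity⟩, fun n => (2 ^ r n - 1) / κ, fun n => Matrix.of fun i j =>
    (1 / Real.sqrt ((2 ^ r n - 1) / κ : ℕ)) * (-1 : ℝ) ^ (Algebra.trace (ZMod 2) (GaloisField 2 (r n))
        (((a n i : (GaloisField 2 (r n))ˣ) : GaloisField 2 (r n)) * x n j)).val,
    ⟨?_, fun n => ⟨r n, hr0 n, H n, a n, x n, fun i j => rfl⟩, ?_⟩⟩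
  · refine tendsto_atTop_mono (f := fun n : ℕ => n.succPNat) (fun n => ?_) ?_
    · change n + 1 ≤ 2 ^ r n
      exact (Nat.succ_le_succ (hrn n)).trans Nat.lt_two_pow_self
    · exact tendsto_atTop_atTop.2 fun b => ⟨b, fun c hc => by
        change (b : ℕ) ≤ c + 1
        omega⟩
  · have hα : α = 1 / κ := by rw [← hκ, one_div_one_div]
    have h1 : Tendsto (fun n => (1 / κ : ℝ) - (1 / κ) * (1 / 2) ^ r n) atTop (𝓝 (1 / κ - 1 / κ * 0)) :=
      tendsto_const_nhds.sub (((tendsto_pow_atTop_nhds_zero_of_lt_one (by norm_num)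
        (by norm_num)).comp (tendsto_atTop_mono hrn tendsto_id)).const_mul _)
    rw [mul_zero, sub_zero, ← hα] at h1
    refine h1.congr fun n => ?_
    have hκ' : (κ : ℝ) ≠ 0 := by positivity
    simp only [PNat.mk_coe]
    rw [Nat.cast_div (hdvd n) hκ', Nat.cast_sub Nat.one_le_two_pow, hα]
    push_cast
    rw [one_div_pow]
    field_simp

end Hadamard

/-! ### Quadratic exponential sums modulo an arbitrary integer. -/

section GaussSum

variable {n : ℕ} [NeZero n]

/-- The quadratic exponential sum over `ZMod n`. -/
noncomputable def quadraticSum (a b : ZMod n) : ℂ := ∑ t : ZMod n, ZMod.stdAddChar (a * t ^ 2 + b * t)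

lemma quadraticSum_zero_left (b : ZMod n) : quadraticSum 0 b = if b = 0 then (n : ℂ) else 0 := by
  have h := AddChar.sum_mulShift (ψ := ZMod.stdAddChar) b (ZMod.isPrimitive_stdAddChar n)
  simp only [quadraticSum, zero_mul, zero_add, mul_comm b]
  rw [h, ZMod.card]
  simp

lemma card_filter_natCast_mul_eq_zero_le {d : ℕ} (hd : 0 < d) :
    (Finset.univ.filter fun h : ZMod n => (d : ZMod n) * h = 0).card ≤ d := by
  have h := IsAddCyclic.card_nsmul_eq_zero_le (α := ZMod n) hd
  simpa [nsmul_eq_mul] using h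

/-- Weyl differencing: after `s = t + h`, the sum over `t` of the squared modulus is linear in `t`
and vanishes unless `2 c h = 0`, which has at most `2c` solutions. -/
lemma norm_quadraticSum_sq_le {c : ℕ} (hc : 0 < c) (b : ZMod n) :
    ‖quadraticSum (c : ZMod n) b‖ ^ 2 ≤ n * (2 * c) := by
  have hsq : (‖quadraticSum (c : ZMod n) b‖ ^ 2 : ℂ) =
      ∑ h : ZMod n, ZMod.stdAddChar ((c : ZMod n) * h ^ 2 + b * h) *
        (if ((2 * c : ℕ) : ZMod n) * h = 0 then (n : ℂ) else 0) := by
    rw [← Complex.mul_conj', quadraticSum, map_sum, Finset.sum_mul_sum, Finset.sum_comm]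
    have h1 : ∀ t : ZMod n, ∑ s : ZMod n, ZMod.stdAddChar ((c : ZMod n) * s ^ 2 + b * s) *
        (starRingEnd ℂ) (ZMod.stdAddChar ((c : ZMod n) * t ^ 2 + b * t)) =
        ∑ h : ZMod n, ZMod.stdAddChar ((c : ZMod n) * h ^ 2 + b * h) *
          ZMod.stdAddChar (t * (((2 * c : ℕ) : ZMod n) * h)) := by
      intro t
      rw [← Equiv.sum_comp (Equiv.addRight t)]
      refine Finset.sum_congr rfl fun h _ => ?_
      rw [← AddChar.map_neg_eq_conj, ← AddChar.map_add_eq_mul, ← AddChar.map_add_eq_mul]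
      congr 1
      simp only [Equiv.coe_addRight]
      push_cast
      ring
    simp_rw [h1]
    rw [Finset.sum_comm]
    refine Finset.sum_congr rfl fun h _ => ?_
    rw [← Finset.mul_sum, AddChar.sum_mulShift _ (ZMod.isPrimitive_stdAddChar n), ZMod.card]
    simp
  have h2 : ‖(‖quadraticSum (c : ZMod n) b‖ ^ 2 : ℂ)‖ ≤ n * (2 * c) := by
    rw [hsq]
    refine (norm_sum_le _ _).trans ?_
    have h3 : ∀ h : ZMod n, ‖ZMod.stdAddChar ((c : ZMod n) * h ^ 2 + b * h) *
        (if ((2 * c : ℕ) : ZMod n) * h = 0 then (n : ℂ) else 0)‖ =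
        if ((2 * c : ℕ) : ZMod n) * h = 0 then (n : ℝ) else 0 := by
      intro h
      rw [norm_mul, AddChar.norm_apply, one_mul]
      split_ifs <;> simp
    simp_rw [h3]
    rw [← Finset.sum_filter, Finset.sum_const, nsmul_eq_mul, mul_comm]
    gcongr
    exact_mod_cast card_filter_natCast_mul_eq_zero_le (n := n) (d := 2 * c) (by positivity)
  simpa using h2

end GaussSum

/-! ### Incoherent frames from bases of chirps. -/

section Chirp

variable {n κ : ℕ} [NeZero n]

/-- Discrete chirps: the `κ` orthonormal bases of `ℂⁿ` that consist of the vectors with coordinates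
`exp (2πi (a t² + b t) / n) / √n`, together with their multiples by `i`, in real coordinates. -/
noncomputable def chirp (j : Fin κ × ZMod n × Fin 2) (t : ZMod n) : ℂ :=
  Complex.I ^ (j.2.2 : ℕ) * ZMod.stdAddChar (((j.1 : ℕ) : ZMod n) * t ^ 2 + j.2.1 * t)

/-- The real vector of the real and imaginary parts of a chirp. -/
noncomputable def chirpVec (j : Fin κ × ZMod n × Fin 2) : EuclideanSpace ℝ (ZMod n × Fin 2) :=
  WithLp.toLp 2 fun i => (if i.2 = 0 then (chirp j i.1).re else (chirp j i.1).im) / √n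

lemma inner_chirpVec (j j' : Fin κ × ZMod n × Fin 2) :
    inner ℝ (chirpVec j) (chirpVec j') =
      (Complex.I ^ (j.2.2 : ℕ) * (-Complex.I) ^ (j'.2.2 : ℕ) *
        quadraticSum (((j.1 : ℕ) : ZMod n) - ((j'.1 : ℕ) : ZMod n)) (j.2.1 - j'.2.1)).re / n := by
  have h1 : ∀ t, chirp j t * (starRingEnd ℂ) (chirp j' t) =
      Complex.I ^ (j.2.2 : ℕ) * (-Complex.I) ^ (j'.2.2 : ℕ) *
        ZMod.stdAddChar ((((j.1 : ℕ) : ZMod n) - ((j'.1 : ℕ) : ZMod n)) * t ^ 2 +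
          (j.2.1 - j'.2.1) * t) := by
    intro t
    rw [chirp, chirp, map_mul, map_pow, Complex.conj_I, mul_mul_mul_comm, ← AddChar.map_neg_eq_conj,
      ← AddChar.map_add_eq_mul]
    congr 2
    ring
  rw [quadraticSum, Finset.mul_sum, Complex.re_sum, Finset.sum_div, PiLp.inner_apply,
    Fintype.sum_prod_type]
  refine Finset.sum_congr rfl fun t _ => ?_
  rw [← h1]
  have hn : √(n : ℝ) * √n = n := Real.mul_self_sqrt n.cast_nonneg
  have hn0 : √(n : ℝ) ≠ 0 := by
    have : (n : ℝ) ≠ 0 := by exact_mod_cast NeZero.ne n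
    intro h
    rw [h] at hn
    simp_all
  have hn1 : (n : ℝ) ≠ 0 := by exact_mod_cast NeZero.ne n
  simp [chirpVec, Fin.sum_univ_two]
  field_simp
  rw [sq, hn, mul_comm]

lemma norm_I_pow_mul (d e : ℕ) : ‖Complex.I ^ d * (-Complex.I) ^ e‖ = 1 := by simp

lemma abs_inner_chirpVec_le {j j' : Fin κ × ZMod n × Fin 2} (h : j'.1 < j.1) :
    |inner ℝ (chirpVec j) (chirpVec j')| ≤ √(n * (2 * κ)) / n := by
  have hn : (0 : ℝ) < n := by exact_mod_cast NeZero.pos n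
  rw [inner_chirpVec, abs_div, abs_of_pos hn]
  gcongr
  refine (Complex.abs_re_le_norm _).trans ?_
  rw [norm_mul, norm_I_pow_mul, one_mul]
  refine Real.le_sqrt_of_sq_le ?_
  have h' : (j'.1 : ℕ) < j.1 := h
  have hcast : ((j.1 : ℕ) : ZMod n) - ((j'.1 : ℕ) : ZMod n) = (((j.1 : ℕ) - j'.1 : ℕ) : ZMod n) := by
    rw [Nat.cast_sub h'.le]
  rw [hcast]
  -- The quadratic coefficient is a difference of distinct indices below `κ`, so it is a positive
  -- integer at most `κ`.
  refine (norm_quadraticSum_sq_le (by omega) _).trans ?_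
  gcongr
  exact (Nat.sub_le _ _).trans j.1.2.le

lemma inner_chirpVec_of_fst_eq {j j' : Fin κ × ZMod n × Fin 2} (h : j.1 = j'.1) :
    inner ℝ (chirpVec j) (chirpVec j') = if j = j' then 1 else 0 := by
  have hn : (n : ℝ) ≠ 0 := by exact_mod_cast NeZero.ne n
  obtain ⟨a, b, d⟩ := j
  obtain ⟨a', b', d'⟩ := j'
  obtain rfl : a = a' := h
  rw [inner_chirpVec]
  simp only [sub_self, quadraticSum_zero_left, sub_eq_zero, Prod.mk.injEq, true_and]
  by_cases hb : b = b'
  · subst hb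
    fin_cases d <;> fin_cases d' <;> simp [hn]
  · simp [hb]

lemma orthonormal_chirpVec (a : Fin κ) :
    Orthonormal ℝ fun b : ZMod n × Fin 2 => (chirpVec (a, b) : EuclideanSpace ℝ (ZMod n × Fin 2)) := by
  classical
  rw [orthonormal_iff_ite]
  intro b b'
  refine (inner_chirpVec_of_fst_eq (j := (a, b)) (j' := (a, b')) rfl).trans ?_
  simp

/-- Bessel's inequality in each of the `κ` orthonormal families. -/
lemma sum_inner_chirpVec_sq_le (x : EuclideanSpace ℝ (ZMod n × Fin 2)) :
    ∑ j : Fin κ × ZMod n × Fin 2, inner ℝ (chirpVec j) x ^ 2 ≤ κ * ‖x‖ ^ 2 := by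
  rw [Fintype.sum_prod_type]
  calc _ ≤ ∑ _a : Fin κ, ‖x‖ ^ 2 := by
        refine Finset.sum_le_sum fun a _ => ?_
        simpa using (orthonormal_chirpVec a).sum_inner_products_le x (s := Finset.univ)
    _ = κ * ‖x‖ ^ 2 := by simp

/-- Only `M` of the `2 * κ * n` chirps are kept. Discarding columns preserves the coherence and the
upper frame bound, though not tightness, so any `M` can be reached. -/
lemma exists_isIncoherent_hasFrameBound {M N : ℕ} (hN : N = 2 * n) (hM : M ≤ 2 * κ * n) :
    ∃ A : Matrix (Fin N) (Fin M) ℝ,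
      IsIncoherent A (√(n * (2 * κ)) / n) ∧ HasFrameBound A κ := by
  obtain ⟨eI⟩ : Nonempty (Fin N ≃ ZMod n × Fin 2) :=
    ⟨(Fintype.equivFinOfCardEq (by simp [hN, mul_comm])).symm⟩
  obtain ⟨eJ⟩ : Nonempty (Fin (2 * κ * n) ≃ Fin κ × ZMod n × Fin 2) :=
    ⟨(Fintype.equivFinOfCardEq (by simp; ring)).symm⟩
  have hinj : Function.Injective fun j : Fin M => eJ (Fin.castLE hM j) :=
    eJ.injective.comp (Fin.castLE_injective hM)
  set A : Matrix (Fin N) (Fin M) ℝ :=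
    Matrix.of fun i j => (chirpVec (eJ (Fin.castLE hM j)) : EuclideanSpace ℝ _) (eI i) with hA
  have hdot : ∀ j k, A.col j ⬝ᵥ A.col k =
      inner ℝ (chirpVec (eJ (Fin.castLE hM j))) (chirpVec (eJ (Fin.castLE hM k))) := by
    intro j k
    rw [PiLp.inner_apply, ← Equiv.sum_comp eI]
    refine Finset.sum_congr rfl fun i _ => ?_
    simp only [hA, Matrix.col_apply, Matrix.of_apply, RCLike.inner_apply, conj_trivial]
    exact mul_comm _ _
  refine ⟨A, ⟨fun k => ?_, fun j k hjk => ?_⟩, fun w => ?_⟩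
  · rw [hdot, inner_chirpVec_of_fst_eq rfl, if_pos rfl]
  · rw [hdot]
    rcases lt_trichotomy (eJ (Fin.castLE hM j)).1 (eJ (Fin.castLE hM k)).1 with h | h | h
    · rw [real_inner_comm]
      exact abs_inner_chirpVec_le h
    · rw [inner_chirpVec_of_fst_eq h, if_neg (fun h => hjk (hinj h)), abs_zero]
      positivity
    · exact abs_inner_chirpVec_le h
  · set x : EuclideanSpace ℝ (ZMod n × Fin 2) := WithLp.toLp 2 fun i => w (eI.symm i) with hx
    have hxw : ‖x‖ ^ 2 = w ⬝ᵥ w := by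
      rw [EuclideanSpace.real_norm_sq_eq, ← Equiv.sum_comp eI]
      simp [hx, dotProduct, sq]
    have hcol : ∀ j, (Aᵀ *ᵥ w) j = inner ℝ (chirpVec (eJ (Fin.castLE hM j))) x := by
      intro j
      rw [PiLp.inner_apply, ← Equiv.sum_comp eI]
      change ∑ i, Aᵀ j i * w i = _
      refine Finset.sum_congr rfl fun i _ => ?_
      simp only [hA, hx, Matrix.transpose_apply, Matrix.of_apply, RCLike.inner_apply,
        conj_trivial, Equiv.symm_apply_apply]
      exact mul_comm _ _
    rw [← hxw]
    refine le_trans ?_ (sum_inner_chirpVec_sq_le x)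
    calc (Aᵀ *ᵥ w) ⬝ᵥ (Aᵀ *ᵥ w) = ∑ j : Fin M, inner ℝ (chirpVec (eJ (Fin.castLE hM j))) x ^ 2 := by
          simp [dotProduct, hcol, sq]
      _ = ∑ j ∈ (Finset.univ.map ⟨_, hinj⟩ : Finset (Fin κ × ZMod n × Fin 2)),
          inner ℝ (chirpVec j) x ^ 2 := by simp
      _ ≤ ∑ j : Fin κ × ZMod n × Fin 2, inner ℝ (chirpVec j) x ^ 2 :=
        Finset.sum_le_sum_of_subset_of_nonneg (Finset.subset_univ _)
          fun _ _ _ => sq_nonneg _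

end Chirp

/-! ### The lower bound on the optimal exponent. -/

section Achievability

/-- Ties go to the smallest maximizing index, which cuts each decision region out by finitely many
linear inequalities and their negations. -/
lemma exists_measurable_isModifiedRDD {M N : ℕ} (hM : 0 < M) (A : Matrix (Fin N) (Fin M) ℝ) :
    ∃ φ : (Fin N → ℝ) → Fin M, Measurable φ ∧ IsModifiedRDD A φ := by
  classical
  have : Nonempty (Fin M) := ⟨⟨0, hM⟩⟩
  let P : (Fin N → ℝ) → Fin M → Prop := fun u k => ∀ j, A.col j ⬝ᵥ u ≤ A.col k ⬝ᵥ u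
  have hP : ∀ u, (Finset.univ.filter (P u)).Nonempty := by
    intro u
    obtain ⟨k, -, hk⟩ := Finset.exists_max_image Finset.univ (fun k => A.col k ⬝ᵥ u)
      Finset.univ_nonempty
    exact ⟨k, Finset.mem_filter.2 ⟨Finset.mem_univ _, fun j => hk j (Finset.mem_univ _)⟩⟩
  have hm : ∀ j, Measurable fun u : Fin N → ℝ => A.col j ⬝ᵥ u := fun j => by
    simp only [dotProduct]
    fun_prop
  have hmeas : ∀ k, MeasurableSet {u | P u k} := by
    intro k
    have : {u | P u k} = ⋂ j, {u | A.col j ⬝ᵥ u ≤ A.col k ⬝ᵥ u} := by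
      ext u
      simp [P]
    rw [this]
    exact MeasurableSet.iInter fun j => measurableSet_le (hm j) (hm k)
  refine ⟨fun u => (Finset.univ.filter (P u)).min' (hP u), ?_, fun u k => ?_⟩
  · refine measurable_to_countable' fun k => ?_
    have : (fun u => (Finset.univ.filter (P u)).min' (hP u)) ⁻¹' {k} =
        {u | P u k} ∩ ⋂ i, ⋂ _ : i < k, {u | P u i}ᶜ := by
      ext u
      simp only [Set.mem_preimage, Set.mem_singleton_iff, Set.mem_inter_iff, Set.mem_iInter,
        Set.mem_compl_iff, Set.mem_ofPred_eq]
      constructor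
      · rintro rfl
        refine ⟨(Finset.mem_filter.1 (Finset.min'_mem _ (hP u))).2, fun i hi hPi => ?_⟩
        exact not_lt.2 (Finset.min'_le _ i (Finset.mem_filter.2 ⟨Finset.mem_univ _, hPi⟩)) hi
      · rintro ⟨hk, hlt⟩
        refine le_antisymm (Finset.min'_le _ k (Finset.mem_filter.2 ⟨Finset.mem_univ _, hk⟩)) ?_
        refine Finset.le_min' _ _ _ fun i hi => ?_
        exact not_lt.1 fun h => hlt i h (Finset.mem_filter.1 hi).2
    rw [this]
    exact (hmeas k).inter (MeasurableSet.iInter fun i => MeasurableSet.iInter fun _ =>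
      (hmeas i).compl)
  · exact (Finset.mem_filter.1 (Finset.min'_mem _ (hP u))).2 k

lemma tendsto_pnat_coe_atTop : Tendsto (fun M : ℕ+ => ((M : ℕ) : ℝ)) atTop atTop :=
  tendsto_coe_atTop tendsto_id

lemma exists_incoherent_frames {κ : ℕ} (hκ : 0 < κ) :
    ∃ (N : ℕ+ → ℕ) (A : ∀ M : ℕ+, Matrix (Fin (N M)) (Fin M) ℝ) (δ : ℕ+ → ℝ),
      Monotone N ∧ (∀ M : ℕ+, N M ≤ M) ∧
      Tendsto (fun M : ℕ+ => (N M : ℝ) / (M : ℕ)) atTop (𝓝 (1 / κ)) ∧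
      Tendsto δ atTop (𝓝 0) ∧
      ∀ᶠ M in atTop, IsIncoherent (A M) (δ M) ∧ HasFrameBound (A M) κ := by
  -- For `κ = 1` the identity matrix is used: the chirp dimension `2 * n M` would exceed an odd `M`.
  obtain rfl | hκ2 := eq_or_lt_of_le (Nat.succ_le_iff.2 hκ)
  · refine ⟨fun M => M, fun M => 1, fun _ => 0, fun a b h => h, fun M => le_rfl, ?_,
      tendsto_const_nhds, Eventually.of_forall fun M => ⟨⟨fun k => ?_, fun j k hjk => ?_⟩,
        hasFrameBound_of_mul_transpose ?_⟩⟩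
    · simp
    · simp [Matrix.col, Matrix.one_apply, dotProduct]
    · simp [Matrix.col, Matrix.one_apply, dotProduct, hjk.symm]
    · simp
  -- `n M = ⌈M / (2κ)⌉`, the least number with enough chirps for `M` columns.
  · set n : ℕ+ → ℕ := fun M => ((M : ℕ) + 2 * κ - 1) / (2 * κ) with hn
    have hn0 : ∀ M, 0 < n M := fun M => Nat.div_pos (by have := M.pos; omega) (by omega)
    have hle : ∀ M : ℕ+, (M : ℕ) ≤ 2 * κ * n M := by
      intro M
      have h1 := Nat.div_add_mod ((M : ℕ) + 2 * κ - 1) (2 * κ)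
      have h2 := Nat.mod_lt ((M : ℕ) + 2 * κ - 1) (y := 2 * κ) (by omega)
      have := M.pos
      simp only [hn]
      omega
    have hge : ∀ M : ℕ+, 2 * κ * n M ≤ M + 2 * κ - 1 := fun M => Nat.mul_div_le _ _
    have hN : ∀ M : ℕ+, 4 ≤ (M : ℕ) → 2 * n M ≤ M := by
      intro M hM
      have h1 : 4 * n M ≤ M + 3 := by
        by_contra! h
        have h2 := hge M
        obtain ⟨b, hb⟩ : ∃ b, κ = b + 2 := ⟨κ - 2, by omega⟩
        obtain ⟨c, hc⟩ : ∃ c, n M = c + 1 := ⟨n M - 1, by have := hn0 M; omega⟩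
        rw [hb, hc] at h2
        rw [hc] at h
        have h3 : 2 * (b + 2) * (c + 1) = 2 * (b * c) + 4 * c + 2 * (b + 2) := by ring
        rw [h3] at h2
        omega
      omega
    -- The value `0` for small `M` secures `N M ≤ M` (at `M = 1`, `2 * n M = 2`) and monotonicity,
    -- without affecting the limits.
    set N : ℕ+ → ℕ := fun M => if (M : ℕ) < 4 then 0 else 2 * n M with hNdef
    have hA : ∀ M : ℕ+, ∃ A : Matrix (Fin (N M)) (Fin M) ℝ, 4 ≤ (M : ℕ) →
        IsIncoherent A (√(n M * (2 * κ)) / n M) ∧ HasFrameBound A κ := by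
      intro M
      by_cases hM : (M : ℕ) < 4
      · exact ⟨0, fun h => absurd h (not_le.2 hM)⟩
      · have : NeZero (n M) := ⟨(hn0 M).ne'⟩
        obtain ⟨A, hA⟩ := exists_isIncoherent_hasFrameBound (n := n M) (κ := κ) (N := N M)
          (by simp [hNdef, hM]) (hle M)
        exact ⟨A, fun _ => hA⟩
    choose A hA using hA
    have h4 : ∀ᶠ M : ℕ+ in atTop, 4 ≤ (M : ℕ) := by
      filter_upwards [eventually_ge_atTop (4 : ℕ+)] with M hM
      exact hM
    have hκ' : (0 : ℝ) < κ := mod_cast hκ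
    refine ⟨N, A, fun M => √(n M * (2 * κ)) / n M, ?_, ?_, ?_, ?_, ?_⟩
    · intro a b hab
      have hab' : (a : ℕ) ≤ b := hab
      simp only [hNdef]
      split_ifs with ha hb
      · exact le_rfl
      · exact Nat.zero_le _
      · omega
      · exact Nat.mul_le_mul_left _ (Nat.div_le_div_right (by omega))
    · intro M
      simp only [hNdef]
      split_ifs with h
      · exact Nat.zero_le _
      · exact hN M (not_lt.1 h)
    · have hup : Tendsto (fun M : ℕ+ => 1 / (κ : ℝ) + 2 / (M : ℕ)) atTop (𝓝 (1 / κ + 0)) :=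
        tendsto_const_nhds.add (tendsto_const_nhds.div_atTop tendsto_pnat_coe_atTop)
      rw [add_zero] at hup
      refine tendsto_of_tendsto_of_tendsto_of_le_of_le' tendsto_const_nhds hup ?_ ?_
      · filter_upwards [h4] with M hM
        have hM0 : (0 : ℝ) < (M : ℕ) := by simp
        have h : ((M : ℕ) : ℝ) ≤ 2 * κ * n M := mod_cast hle M
        simp only [hNdef, not_lt.2 hM, if_false]
        rw [div_le_div_iff₀ hκ' hM0]
        push_cast
        linarith
      · filter_upwards [h4] with M hM
        have hM0 : (0 : ℝ) < (M : ℕ) := by simp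
        have h : 2 * κ * (n M : ℝ) ≤ (M : ℕ) + 2 * κ := by
          have := hge M
          exact_mod_cast (by omega : 2 * κ * n M ≤ M + 2 * κ)
        simp only [hNdef, not_lt.2 hM, if_false]
        rw [div_add_div _ _ hκ'.ne' hM0.ne', div_le_div_iff₀ hM0 (by positivity)]
        push_cast
        nlinarith
    · have hntop : Tendsto (fun M => (n M : ℝ)) atTop atTop := by
        refine tendsto_atTop_mono (f := fun M : ℕ+ => ((M : ℕ) : ℝ) / (2 * κ)) (fun M => ?_)
          (tendsto_pnat_coe_atTop.atTop_div_const (by positivity))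
        have h : ((M : ℕ) : ℝ) ≤ 2 * κ * n M := mod_cast hle M
        rw [div_le_iff₀ (by positivity)]
        linarith
      have h : Tendsto (fun M => √(2 * κ) / √(n M : ℝ)) atTop (𝓝 0) :=
        tendsto_const_nhds.div_atTop (Real.tendsto_sqrt_atTop.comp hntop)
      refine h.congr fun M => ?_
      have hnM : (0 : ℝ) < n M := mod_cast hn0 M
      rw [Real.sqrt_mul hnM.le, div_eq_div_iff (Real.sqrt_pos.2 hnM).ne' hnM.ne']
      linear_combination (-√(2 * κ)) * Real.mul_self_sqrt hnM.le
    · filter_upwards [h4] with M hM using hA M hM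

variable {𝓔 σ β α : ℝ} {T : ℕ+ → ℕ}

lemma tendsto_effective_snr {ι : Type*} {l : Filter ι} {δ τ : ι → ℝ} {s : ℝ} {κ : ℝ} (hκ : 0 < κ)
    (hδ : Tendsto δ l (𝓝 0)) (hτ : Tendsto τ l (𝓝 κ)) :
    Tendsto (fun n => (1 - δ n) * s / (2 * τ n)) l (𝓝 (1 / κ * s / 2)) := by
  have h := ((hδ.const_sub 1).mul_const s).div (hτ.const_mul 2) (by positivity)
  have hlim : (1 - 0) * s / (2 * κ) = 1 / κ * s / 2 := by
    rw [sub_zero]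
    field_simp
  rwa [hlim] at h

lemma le_optExponent (h𝓔 : 0 < 𝓔) (hσ : 0 < σ) (hT : ∀ M : ℕ+, (M : ℕ) ≤ T M)
    (hTβ : Tendsto (fun M : ℕ+ => (T M : ℝ) / (M : ℕ)) atTop (𝓝 β)) {κ : ℕ} (hκ : 0 < κ) :
    (((β - 1) / 2 * Real.log (1 + 1 / κ * snr 𝓔 σ / 2) : ℝ) : EReal) ≤
      optExponent T (1 / κ) 𝓔 σ := by
  obtain ⟨N, A, δ, hmono, hNM, hcomp, hδ, hA⟩ := exists_incoherent_frames hκ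
  choose φ hφm hφ using fun M : ℕ+ => exists_measurable_isModifiedRDD M.pos (A M)
  have hκ' : (0 : ℝ) < κ := mod_cast hκ
  have hsnr := snr_pos h𝓔 hσ
  refine le_iSup₂_of_le _ ⟨N, A, φ, hmono, hNM, hcomp, hφm, ?_⟩ le_rfl
  have hlim := tendsto_rate_of_upper (l := atTop) (m := fun M : ℕ+ => M) (T := T)
    (q := fun _ => 1) (θ := 0) tendsto_id hTβ
    (tendsto_const_nhds.div_atTop tendsto_pnat_coe_atTop)
    (tendsto_effective_snr (s := snr 𝓔 σ) hκ' hδ tendsto_const_nhds) (by positivity)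
  rw [add_zero] at hlim
  rw [← hlim.liminf_eq]
  refine liminf_le_liminf ?_
  filter_upwards [hA, hδ.eventually (gt_mem_nhds one_pos)] with M hM hδM
  exact rate_anti M (avgErrProb_le fun k =>
    errProb_rdd_le (hT M) h𝓔 hσ hM.1 hδM hκ' hM.2 (hφ M) k)

end Achievability

/-! ### Asymptotics for group Hadamard sequences. -/

section HadamardExponents

variable {𝓔 σ β α : ℝ} {T : ℕ+ → ℕ} {M : ℕ → ℕ+} {N : ℕ → ℕ}
  {A : ∀ n, Matrix (Fin (N n)) (Fin (M n)) ℝ}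

namespace IsHadamardSeq

lemma tendsto_coherence (hA : IsHadamardSeq α M N A) (hα : 0 < α) :
    Tendsto (fun n => √((M n : ℕ) : ℝ) / N n) atTop (𝓝 0) := by
  have h1 : Tendsto (fun n => 1 / √((M n : ℕ) : ℝ)) atTop (𝓝 0) :=
    tendsto_const_nhds.div_atTop (Real.tendsto_sqrt_atTop.comp (tendsto_coe_atTop hA.size))
  have h := h1.div hA.compression hα.ne'
  rw [zero_div] at h
  refine h.congr fun n => ?_
  have hM0 : (0 : ℝ) < (M n : ℕ) := by simp
  have hN0 : (0 : ℝ) < N n := mod_cast (hA.hadamard n).pos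
  have hs := Real.mul_self_sqrt hM0.le
  have hs0 : 0 < √((M n : ℕ) : ℝ) := Real.sqrt_pos.2 hM0
  simp only [Pi.div_apply]
  field_simp
  linarith

lemma tendsto_frameBound (hA : IsHadamardSeq α M N A) (hα : 0 < α) :
    Tendsto (fun n => ((M n : ℕ) : ℝ) / N n) atTop (𝓝 (1 / α)) := by
  have h := hA.compression.inv₀ hα.ne'
  rw [← one_div] at h
  exact h.congr fun n => inv_div _ _

lemma tendsto_one_div (hA : IsHadamardSeq α M N A) :
    Tendsto (fun n => (1 : ℝ) / (M n : ℕ)) atTop (𝓝 0) :=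
  tendsto_const_nhds.div_atTop (tendsto_coe_atTop hA.size)

lemma frameBound_pos (hA : IsHadamardSeq α M N A) (n : ℕ) : (0 : ℝ) < ((M n : ℕ) : ℝ) / N n := by
  have hN0 : (0 : ℝ) < N n := mod_cast (hA.hadamard n).pos
  have hM0 : (0 : ℝ) < (M n : ℕ) := by simp
  positivity

/-- The finite-size bounds are uniform in the true hypothesis. Any `p n` that respects all such
uniform bounds is therefore squeezed, and this covers both the average and each single conditional
error probability. -/
lemma tendsto_rate_rdd_of_bounds (hA : IsHadamardSeq α M N A) (hα : 0 < α) (h𝓔 : 0 < 𝓔)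
    (hσ : 0 < σ) (hT : ∀ M : ℕ+, (M : ℕ) ≤ T M)
    (hTβ : Tendsto (fun M : ℕ+ => (T M : ℝ) / (M : ℕ)) atTop (𝓝 β))
    {φ : ∀ n, (Fin (N n) → ℝ) → Fin (M n)} (hφ : ∀ n, IsModifiedRDD (A n) (φ n)) {p : ℕ → ℝ≥0∞}
    (hup : ∀ n B, (∀ k, errProb (T (M n)) 𝓔 σ (A n) (fun _ => φ n) k ≤ B) → p n ≤ B)
    (hlow : ∀ n B, (∀ k, B ≤ errProb (T (M n)) 𝓔 σ (A n) (fun _ => φ n) k) → B ≤ p n) :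
    Tendsto (fun n => rate (M n) (p n)) atTop
      (𝓝 (((β - 1) / 2 * Real.log (1 + α * snr 𝓔 σ / 2) : ℝ) : EReal)) := by
  have hsnr := snr_pos h𝓔 hσ
  have hδ := hA.tendsto_coherence hα
  have hτ := hA.tendsto_frameBound hα
  have hr := tendsto_effective_snr (s := snr 𝓔 σ) (one_div_pos.2 hα) hδ hτ
  rw [one_div_one_div] at hr
  have hε : Tendsto (fun n => (√((M n : ℕ) : ℝ))⁻¹) atTop (𝓝 0) :=
    (Real.tendsto_sqrt_atTop.comp (tendsto_coe_atTop hA.size)).inv_tendsto_atTop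
  have hr' : Tendsto (fun n => (1 + (√((M n : ℕ) : ℝ))⁻¹) * (1 + √((M n : ℕ) : ℝ) / N n) *
      snr 𝓔 σ / (2 * (((M n : ℕ) : ℝ) / N n))) atTop (𝓝 (α * snr 𝓔 σ / 2)) := by
    have h := (((hε.const_add 1).mul (hδ.const_add 1)).mul_const (snr 𝓔 σ)).div (hτ.const_mul 2)
      (by positivity)
    have hlim : (1 + 0) * (1 + 0) * snr 𝓔 σ / (2 * (1 / α)) = α * snr 𝓔 σ / 2 := by
      rw [add_zero, one_mul, one_mul]
      field_simp
    rwa [hlim] at h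
  have hlimU := tendsto_rate_of_upper (T := fun n => T (M n)) hA.size (hTβ.comp hA.size)
    hA.tendsto_one_div hr (by positivity)
  have hlimL := tendsto_rate_of_lower (T := fun n => T (M n)) hA.size (hTβ.comp hA.size)
    hA.tendsto_one_div hr' (by positivity)
  rw [add_zero] at hlimU hlimL
  refine tendsto_of_tendsto_of_tendsto_of_le_of_le' hlimU hlimL ?_ ?_
  · filter_upwards [hδ.eventually (gt_mem_nhds one_pos)] with n hn
    exact rate_anti _ (hup n _ fun k => errProb_rdd_le (hT _) h𝓔 hσ (hA.hadamard n).isIncoherent hn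
      (hA.frameBound_pos n) (hasFrameBound_of_mul_transpose (hA.hadamard n).mul_transpose) (hφ n) k)
  · filter_upwards [hδ.eventually (gt_mem_nhds one_pos)] with n hn
    have hM0 : (0 : ℝ) < (M n : ℕ) := by simp
    exact rate_anti _ (hlow n _ fun k => le_errProb_rdd (hT _) (hA.hadamard n).two_le h𝓔 hσ
      (hA.hadamard n).isIncoherent hn (hA.frameBound_pos n) (hA.hadamard n).mul_transpose (hφ n) k
      (by positivity))

/-- The term `N` in the power `(T - M + N) / 2` contributes the extra `α`, since `N / M → α`. -/
lemma le_liminf_rate_ml (hA : IsHadamardSeq α M N A) (hα : 0 < α) (h𝓔 : 0 < 𝓔)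
    (hσ : 0 < σ) (hT : ∀ M : ℕ+, (M : ℕ) ≤ T M)
    (hTβ : Tendsto (fun M : ℕ+ => (T M : ℝ) / (M : ℕ)) atTop (𝓝 β))
    {ψ : ∀ n, Matrix (Fin (M n)) (Fin (M n)) ℝ → (Fin (N n) → ℝ) → Fin (M n)}
    (hψ : ∀ n, IsMLDetector σ (A n) (ψ n)) :
    (((β - 1 + α) / 2 * Real.log (1 + α * snr 𝓔 σ / 2) : ℝ) : EReal) ≤
      liminf (fun n => rate (M n) (avgErrProb (T (M n)) 𝓔 σ (A n) (ψ n))) atTop := by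
  have hsnr := snr_pos h𝓔 hσ
  have hδ := hA.tendsto_coherence hα
  have hr := tendsto_effective_snr (s := snr 𝓔 σ) (one_div_pos.2 hα) hδ (hA.tendsto_frameBound hα)
  rw [one_div_one_div] at hr
  have hlim := tendsto_rate_of_upper (T := fun n => T (M n)) hA.size (hTβ.comp hA.size)
    hA.compression hr (by positivity)
  rw [← hlim.liminf_eq]
  refine liminf_le_liminf ?_
  filter_upwards [hδ.eventually (gt_mem_nhds one_pos)] with n hn
  exact rate_anti _ (avgErrProb_le fun k => errProb_ml_le (hT _) h𝓔 hσ
    (hA.hadamard n).isIncoherent hn (hA.frameBound_pos n) (hA.hadamard n).mul_transpose (hψ n) k)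

end IsHadamardSeq

end HadamardExponents

end ApproxSuff

/-! ### The theorem. -/

open ApproxSuff in
theorem theorem3 (𝓔 σ : ℝ) (h𝓔 : 0 < 𝓔) (hσ : 0 < σ)
    (β : ℝ) (hβ : 1 ≤ β)
    (T : ℕ+ → ℕ) (hT : ∀ M : ℕ+, (M : ℕ) ≤ T M)
    (hTβ : Tendsto (fun M : ℕ+ => (T M : ℝ) / (M : ℕ)) atTop (𝓝 β))
    (α : ℝ) (hα0 : 0 < α) (hα1 : α ≤ 1) (κ : ℕ) (hκ : 1 / α = κ) :
    -- the lower bound on the optimal exponent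
    (((β - 1) / 2 * Real.log (1 + α * snr 𝓔 σ / 2) : ℝ) : EReal) ≤ optExponent T α 𝓔 σ ∧
    -- group Hadamard sensing matrices of compression rate `α` exist when `1 / α` is odd
    (Odd κ → ∃ (M : ℕ → ℕ+) (N : ℕ → ℕ) (A : ∀ n, Matrix (Fin (N n)) (Fin (M n)) ℝ),
      IsHadamardSeq α M N A) ∧
    -- all such sensing matrices, with the modified reduced-dimensionality detector
    ∀ (M : ℕ → ℕ+) (N : ℕ → ℕ) (A : ∀ n, Matrix (Fin (N n)) (Fin (M n)) ℝ),
      IsHadamardSeq α M N A →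
      ∀ φ : ∀ n, (Fin (N n) → ℝ) → Fin (M n), (∀ n, IsModifiedRDD (A n) (φ n)) →
        -- the exponent, as a limit inferior, and its comparison with the optimal one
        liminf (fun n => rate (M n) (avgErrProb (T (M n)) 𝓔 σ (A n) (fun _ => φ n))) atTop =
          (((β - 1) / 2 * Real.log (1 + α * snr 𝓔 σ / 2) : ℝ) : EReal) ∧
        liminf (fun n => rate (M n) (avgErrProb (T (M n)) 𝓔 σ (A n) (fun _ => φ n))) atTop ≤
          optExponent T α 𝓔 σ ∧
        -- tightness: the rate converges to this value
        Tendsto (fun n => rate (M n) (avgErrProb (T (M n)) 𝓔 σ (A n) (fun _ => φ n))) atTop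
          (𝓝 (((β - 1) / 2 * Real.log (1 + α * snr 𝓔 σ / 2) : ℝ) : EReal)) ∧
        -- the same under any fixed true hypothesis
        (∀ k : ∀ n, Fin (M n),
          Tendsto (fun n => rate (M n) (errProb (T (M n)) 𝓔 σ (A n) (fun _ => φ n) (k n))) atTop
            (𝓝 (((β - 1) / 2 * Real.log (1 + α * snr 𝓔 σ / 2) : ℝ) : EReal))) ∧
        -- the exponent is strictly smaller than that of the maximum likelihood detector
        ∀ ψ : ∀ n, Matrix (Fin (M n)) (Fin (M n)) ℝ → (Fin (N n) → ℝ) → Fin (M n),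
          (∀ n, IsMLDetector σ (A n) (ψ n)) →
          liminf (fun n => rate (M n) (avgErrProb (T (M n)) 𝓔 σ (A n) (fun _ => φ n))) atTop <
            liminf (fun n => rate (M n) (avgErrProb (T (M n)) 𝓔 σ (A n) (ψ n))) atTop := by
  have hκ' : (0 : ℝ) < κ := by rw [← hκ]; positivity
  have hκ0 : 0 < κ := mod_cast hκ'
  have hα : α = 1 / κ := by rw [← hκ, one_div_one_div]
  have hopt := le_optExponent h𝓔 hσ hT hTβ hκ0
  rw [← hα] at hopt
  have hsnr := snr_pos h𝓔 hσ
  refine ⟨hopt, exists_isHadamardSeq hκ, fun M N A hA φ hφ => ?_⟩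
  have hlim := hA.tendsto_rate_rdd_of_bounds hα0 h𝓔 hσ hT hTβ hφ
    (p := fun n => avgErrProb (T (M n)) 𝓔 σ (A n) (fun _ => φ n))
    (fun n B hB => avgErrProb_le hB) (fun n B hB => le_avgErrProb (M n).ne_zero hB)
  refine ⟨hlim.liminf_eq, hlim.liminf_eq.trans_le hopt, hlim, fun k => ?_, fun ψ hψ => ?_⟩
  · exact hA.tendsto_rate_rdd_of_bounds hα0 h𝓔 hσ hT hTβ hφ
      (fun n B hB => hB (k n)) (fun n B hB => hB (k n))
  · rw [hlim.liminf_eq]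
    refine lt_of_lt_of_le ?_ (hA.le_liminf_rate_ml hα0 h𝓔 hσ hT hTβ hψ)
    rw [EReal.coe_lt_coe_iff]
    have hlog : 0 < Real.log (1 + α * snr 𝓔 σ / 2) := Real.log_pos (by
      have : 0 < α * snr 𝓔 σ / 2 := by positivity
      linarith)
    -- The exponents share the positive logarithm, so only `β - 1 < β - 1 + α` remains.
    gcongr
    linarith
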